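/- Let $0<b<1$, $1<a<b^{-1}$, $0<c<b$ (the interior of $R=\{(a,b,c): 1\le a\le b^{-1},\ 0<c\le b\}$). Put $D=a^4b^2c^2+3a^4+3a^2b^2+3a^2c^2+3b^2c^2-3$, $$A(a,b,c)=\sqrt{\frac{3\,(a^4c^2+a^2b^2c^2+a^2+c^2)}{D}},\qquad A=A(a,b,c),\qquad B=A(a,c,b),$$ $$X(u)=A\Big(u+\frac{a^2+b^2}{u}-\frac{a^2b^2}{3u^3}\Big),\qquad Y(u)=B\Big(\frac1u+(a^2+c^2)u-\frac{a^2c^2}{3}u^3\Big),\qquad \Omega(u)=\int Y(u)X'(u)\,du ,$$ where the primitive $\Omega$ has zero constant of integration; its real part is a single-valued function on $\mathbb C\setminus\{0\}$. Let $\alpha=X(a)$, $\beta=X(b)$. For real $\theta$ let $$r_\pm(\theta)=\sqrt{\tfrac12(a^2+b^2)\pm\sqrt{\tfrac43a^2b^2\sin^2\theta+\tfrac14(a^2-b^2)^2}}\,,$$ with $r_-(\theta):=0$ if $\sin^2\theta\ge\frac34$, and let $U_1,\dots,U_4$ be the following sets of $u=re^{i\theta}$: $U_1=\{r>r_+(\theta)\}$,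 $U_2=\{r_-(\theta)<r<r_+(\theta)\}$, $U_3=\{r<r_-(\theta),\ \operatorname{Re}u<0\}$, $U_4=\{r<r_-(\theta),\ \operatorname{Re}u>0\}$. Then $0<\alpha<\beta$, and $X$ maps $U_1$, $U_2$, $U_3$, $U_4$ bijectively onto the four sheets $$\mathbb C\setminus[-\alpha,\alpha],\qquad \mathbb C\setminus\big((-\infty,-\beta]\cup[-\alpha,\alpha]\cup[\beta,\infty)\big),\qquad \mathbb C\setminus(-\infty,-\beta],\qquad \mathbb C\setminus[\beta,\infty),$$ respectively, with holomorphic inverses $u_1,u_2,u_3,u_4$. Write $\Omega_j(z)=\Omega(u_j(z))=\phi_j(z)+i\psi_j(z)$. Each of the following inequalities holds for some $\delta>0$ (which may depend on $a,b,c$) at all points, off the cut, of the indicated lens with vertices at the branch points and sides of slope $\pm\delta$: 1. $\phi_4(z)-\phi_2(z)>0$ in the lens around $[\beta,\infty)$: for $\operatorname{Re}z>\beta$ and $0<|\operatorname{Im}z|<\delta(\operatorname{Re}z-\beta)$; 2. $\phi_3(z)-\phi_2(z)>0$ in the lens around $(-\infty,-\beta]$: for $\operatorname{Re}z<-\beta$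 and $0<|\operatorname{Im}z|<\delta(-\beta-\operatorname{Re}z)$; 3. $\phi_2(z)-\phi_1(z)>0$ in the lens around $[-\alpha,\alpha]$: for $|\operatorname{Re}z|<\alpha$ and $0<|\operatorname{Im}z|<\delta(\alpha-|\operatorname{Re}z|)$. -/

import Mathlib

namespace QuarticSpectralCurve

noncomputable section

/-- The noncritical (generic) parameter range `0 < b < 1`, `1 < a < b⁻¹`, `0 < c < b`: the interior
of `R = {(a, b, c) | 1 ≤ a ≤ b⁻¹, 0 < c ≤ b}`. -/
structure GenericParams (a b c : ℝ) : Prop where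
  b_pos : 0 < b
  b_lt_one : b < 1
  one_lt_a : 1 < a
  a_lt_inv_b : a < b⁻¹
  c_pos : 0 < c
  c_lt_b : c < b

/-- The common denominator `a⁴b²c² + 3a⁴ + 3a²b² + 3a²c² + 3b²c² - 3` (symmetric in `b`, `c`). -/
def den (a b c : ℝ) : ℝ :=
  a ^ 4 * b ^ 2 * c ^ 2 + 3 * a ^ 4 + 3 * a ^ 2 * b ^ 2 + 3 * a ^ 2 * c ^ 2 + 3 * b ^ 2 * c ^ 2 - 3

/-- The scaling constant `A(a, b, c)`; the constant `B(a, b, c)` is `A(a, c, b)`. -/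
def constA (a b c : ℝ) : ℝ :=
  √(3 * (a ^ 4 * c ^ 2 + a ^ 2 * b ^ 2 * c ^ 2 + a ^ 2 + c ^ 2) / den a b c)

/-- The uniformizing function `X(u) = z(u) = A (u + (a² + b²) / u - a² b² / (3 u³))`. -/
def zMap (a b c : ℝ) (u : ℂ) : ℂ :=
  constA a b c * (u + (a ^ 2 + b ^ 2) / u - a ^ 2 * b ^ 2 / (3 * u ^ 3))

/-- The second coordinate `Y(u) = X(u⁻¹; a, c, b) = B (u⁻¹ + (a² + c²) u - a² c² u³ / 3)`. -/
def yMap (a b c : ℝ) (u : ℂ) : ℂ := zMap a c b u⁻¹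

/-- The derivative `X'(u) = A (u² - a²) (u² - b²) / u⁴`. -/
def zMapDeriv (a b c : ℝ) (u : ℂ) : ℂ :=
  constA a b c * ((u ^ 2 - a ^ 2) * (u ^ 2 - b ^ 2) / u ^ 4)

/-- The function `Ω(u) = ∫ Y(u) X'(u) du` (zero constant of integration, principal logarithm).
Only its real part matters below; it does not depend on the branch of the logarithm. -/
def Omega (a b c : ℝ) (u : ℂ) : ℂ :=
  constA a b c * constA a c b *
    (-(a ^ 2 * c ^ 2) / 12 * u ^ 4
      + (3 * (a ^ 2 + c ^ 2) + a ^ 2 * c ^ 2 * (a ^ 2 + b ^ 2)) / 6 * u ^ 2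
      + ((a ^ 2 + b ^ 2) - (a ^ 2 + c ^ 2) * (a ^ 2 * b ^ 2)) / 2 / u ^ 2
      - a ^ 2 * b ^ 2 / 4 / u ^ 4
      - den a b c / 3 * Complex.log u)

/-- The branch point `α = X(a)`. -/
def alpha (a b c : ℝ) : ℝ := (zMap a b c a).re

/-- The branch point `β = X(b)`. -/
def beta (a b c : ℝ) : ℝ := (zMap a b c b).re

/-- The outer polar curve `r = r₊(θ)`: the preimage of the cut between sheets 1 and 2. -/
def rPlus (a b θ : ℝ) : ℝ :=
  √((a ^ 2 + b ^ 2) / 2 + √(4 / 3 * a ^ 2 * b ^ 2 * Real.sin θ ^ 2 + (a ^ 2 - b ^ 2) ^ 2 / 4))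

/-- The inner polar curve `r = r₋(θ)`: for `sin² θ < 3/4` it is the preimage of the cuts between
sheet 2 and sheets 3, 4. For `sin² θ ≥ 3/4` the value is `0` (square root of a number `≤ 0`):
there is no inner curve in these directions. -/
def rMinus (a b θ : ℝ) : ℝ :=
  √((a ^ 2 + b ^ 2) / 2 - √(4 / 3 * a ^ 2 * b ^ 2 * Real.sin θ ^ 2 + (a ^ 2 - b ^ 2) ^ 2 / 4))

/-- Labels of the four sheets. -/
inductive Sheet
  | one
  | two
  | three
  | four

/-- The open region of the uniformizing `u`-plane that corresponds to each sheet: sheet 1 is outside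
the outer curve, sheets 4 and 3 are inside the right and the left loop of the inner curve, and
sheet 2 is the region between the curves. -/
def sheetRegion (a b : ℝ) : Sheet → Set ℂ
  | .one => {u | rPlus a b u.arg < ‖u‖}
  | .two => {u | rMinus a b u.arg < ‖u‖ ∧ ‖u‖ < rPlus a b u.arg}
  | .three => {u | ‖u‖ < rMinus a b u.arg ∧ u.re < 0}
  | .four => {u | ‖u‖ < rMinus a b u.arg ∧ 0 < u.re}

/-- The branch cuts on each sheet: `[-α, α]` on sheet 1; `(-∞, -β]`, `[-α, α]` and `[β, ∞)` on
sheet 2; `(-∞, -β]` on sheet 3; `[β, ∞)` on sheet 4. -/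
def sheetCut (a b c : ℝ) : Sheet → Set ℂ
  | .one => {z | z.im = 0 ∧ |z.re| ≤ alpha a b c}
  | .two => {z | z.im = 0 ∧ (|z.re| ≤ alpha a b c ∨ beta a b c ≤ |z.re|)}
  | .three => {z | z.im = 0 ∧ z.re ≤ -beta a b c}
  | .four => {z | z.im = 0 ∧ beta a b c ≤ z.re}

/-- The uniformization map `u_j(z)`, the inverse of `z(u)` on sheet `j`. -/
def uSheet (a b c : ℝ) (j : Sheet) : ℂ → ℂ :=
  Function.invFunOn (zMap a b c) (sheetRegion a b j)

/-- `φ_j(z) = Re Ω_j(z)`, where `Ω_j(z) = Ω(u_j(z))`. -/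
def phi (a b c : ℝ) (j : Sheet) (z : ℂ) : ℝ := (Omega a b c (uSheet a b c j z)).re

/-- The lens around `[p, ∞)` with straight sides of slopes `±δ` starting at `p`. -/
def lensRight (p δ : ℝ) : Set ℂ := {z | p < z.re ∧ |z.im| < δ * (z.re - p)}

/-- The lens around `(-∞, p]` with straight sides of slopes `±δ` ending at `p`. -/
def lensLeft (p δ : ℝ) : Set ℂ := {z | z.re < p ∧ |z.im| < δ * (p - z.re)}

/-- The lens around `[p, q]` with vertices `p`, `q` and straight sides of slopes `±δ`. -/
def lensBetween (p q δ : ℝ) : Set ℂ := lensRight p δ ∩ lensLeft q δ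

end

theorem zMap_hasDerivAt (a b c : ℝ) {u : ℂ} (hu : u ≠ 0) :
    HasDerivAt (zMap a b c) (zMapDeriv a b c u) u := by
  have h1 : HasDerivAt (fun u : ℂ => u) 1 u := hasDerivAt_id u
  have h2 := (hasDerivAt_const u ((a : ℂ) ^ 2 + b ^ 2)).div h1 hu
  have h3 := (hasDerivAt_const u ((a : ℂ) ^ 2 * b ^ 2)).div ((h1.pow 3).const_mul 3)
    (by simpa using hu)
  have h := ((h1.add h2).sub h3).const_mul (constA a b c : ℂ)
  refine h.congr_deriv ?_
  simp only [zMapDeriv, Pi.pow_apply]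
  field_simp
  push_cast
  ring

/-- `Ω` is a primitive of `Y X'`. -/
theorem Omega_hasDerivAt (a b c : ℝ) {u : ℂ} (hu : u ∈ Complex.slitPlane) :
    HasDerivAt (Omega a b c) (yMap a b c u * zMapDeriv a b c u) u := by
  have hu0 : u ≠ 0 := Complex.slitPlane_ne_zero hu
  have h1 : HasDerivAt (fun u : ℂ => u) 1 u := hasDerivAt_id u
  have t1 := (h1.pow 4).const_mul (-((a : ℂ) ^ 2 * c ^ 2) / 12)
  have t2 := (h1.pow 2).const_mul
    ((3 * ((a : ℂ) ^ 2 + c ^ 2) + a ^ 2 * c ^ 2 * (a ^ 2 + b ^ 2)) / 6)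
  have t3 := (hasDerivAt_const u
    ((((a : ℂ) ^ 2 + b ^ 2) - (a ^ 2 + c ^ 2) * (a ^ 2 * b ^ 2)) / 2)).div (h1.pow 2)
    (by simpa using hu0)
  have t4 := (hasDerivAt_const u ((a : ℂ) ^ 2 * b ^ 2 / 4)).div (h1.pow 4) (by simpa using hu0)
  have t5 := (Complex.hasDerivAt_log hu).const_mul ((den a b c : ℂ) / 3)
  have h := ((((t1.add t2).add t3).sub t4).sub t5).const_mul
    ((constA a b c : ℂ) * constA a c b)
  refine h.congr_deriv ?_
  simp only [zMapDeriv, yMap, zMap, den, Pi.pow_apply]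
  field_simp
  push_cast
  ring

/-- `Re Ω` is even, hence single-valued and smooth on the punctured plane. -/
theorem Omega_re_neg (a b c : ℝ) (u : ℂ) : (Omega a b c (-u)).re = (Omega a b c u).re := by
  have h : Omega a b c (-u) - Omega a b c u =
      ((constA a b c * constA a c b * (den a b c / 3) : ℝ) : ℂ) *
        (Complex.log u - Complex.log (-u)) := by
    simp only [Omega]
    push_cast
    ring_nf
  have h2 := congrArg Complex.re h
  rw [Complex.re_ofReal_mul, Complex.sub_re, Complex.sub_re, Complex.log_re, Complex.log_re,
    norm_neg, sub_self, mul_zero] at h2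
  linarith

end QuarticSpectralCurve

open QuarticSpectralCurve

namespace QuarticSpectralCurve

open Complex Filter Topology
open scoped ComplexConjugate

noncomputable section

/-! Write S for `curveForm` and Q for `densityForm`. Everything rests on two formulas: Im X(u) = A ·
Im u · S(u) / |u|⁶ (`zMap_im`) and Im Y(u) = -B · (Im u / |u|²) · Q(u) (`yMap_im`).

Uniformization. For a fixed direction, S is |u|² times a quadratic in |u|² with roots r₊² and r₋²,
so the four regions are described by the sign of S, by |u|² compared with (a² + b²)/2, and by the
sign of Re u. The critical points ±a, ±b of X lie on S = 0, so X is a local homeomorphism on each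
region. Over the upper half-plane the image of each region is nonempty, open and relatively closed,
hence everything (`surjOn_of_im_pos`); conjugation gives the lower half-plane. Since X(u) = z is a
quartic equation, four regions leave exactly one solution in each. Injectivity extends to real
values because X is open (`injOn_zMap`), and the real values attained are found by calculus on the
real axis.

Inequalities. Since dΩ_j/dz = Y(u_j), the derivative of φ_j in the direction i is -Im Y(u_j), whose
sign is that of Im u_j · Q(u_j). In the upper half-plane Im u_j is negative on sheet 2 and positive
on the others. On the curve S = 0 the form Q depends on |u|² alone; it is positive on the inner
curve and negative on the outer one (`densityForm_pos`, `densityForm_neg`), which is where ab < 1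
and c < b enter. Compactness spreads these signs to thin lenses. The two solutions that meet at a
cut become equal or conjugate there, so the difference of the two φ_j tends to 0; it then increases
along vertical segments leaving the cut. Conjugation and u ↦ -u give the remaining cases. -/

/-- A polynomial whose zero set, off the origin, is the union of the two polar curves. -/
def curveForm (a b : ℝ) (u : ℂ) : ℝ :=
  normSq u ^ 3 - (a ^ 2 + b ^ 2) * normSq u ^ 2 + a ^ 2 * b ^ 2 * normSq u
    - 4 / 3 * a ^ 2 * b ^ 2 * u.im ^ 2

/-- The polynomial that controls the sign of `Im Y`. -/
def densityForm (a c : ℝ) (u : ℂ) : ℝ :=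
  1 - (a ^ 2 + c ^ 2) * normSq u + a ^ 2 * c ^ 2 * normSq u ^ 2
    - 4 / 3 * a ^ 2 * c ^ 2 * normSq u * u.im ^ 2

end

/-! ### Symmetries and imaginary parts of X and Y. -/

theorem continuous_curveForm (a b : ℝ) : Continuous (curveForm a b) := by
  unfold curveForm
  have := Complex.continuous_normSq
  have := Complex.continuous_im
  fun_prop

theorem continuous_densityForm (a c : ℝ) : Continuous (densityForm a c) := by
  unfold densityForm
  have := Complex.continuous_normSq
  have := Complex.continuous_im
  fun_prop

theorem curveForm_conj (a b : ℝ) (u : ℂ) : curveForm a b (conj u) = curveForm a b u := by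
  simp [curveForm]

theorem curveForm_neg (a b : ℝ) (u : ℂ) : curveForm a b (-u) = curveForm a b u := by
  simp [curveForm]

theorem densityForm_conj (a c : ℝ) (u : ℂ) : densityForm a c (conj u) = densityForm a c u := by
  simp [densityForm]

theorem curveForm_ofReal (a b x : ℝ) :
    curveForm a b x = x ^ 2 * ((x ^ 2 - a ^ 2) * (x ^ 2 - b ^ 2)) := by
  simp [curveForm, normSq_ofReal]; ring

theorem zMap_neg (a b c : ℝ) (u : ℂ) : zMap a b c (-u) = -zMap a b c u := by
  simp only [zMap, div_eq_mul_inv, mul_inv, inv_neg, Odd.neg_pow (by decide : Odd 3)]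
  ring

theorem zMap_conj (a b c : ℝ) (u : ℂ) : zMap a b c (conj u) = conj (zMap a b c u) := by
  simp [zMap, map_ofNat]

theorem zMap_ofReal (a b c x : ℝ) : zMap a b c x =
    ((constA a b c * (x + (a ^ 2 + b ^ 2) / x - a ^ 2 * b ^ 2 / (3 * x ^ 3)) : ℝ) : ℂ) := by
  simp [zMap]

theorem zMap_im (a b c : ℝ) {u : ℂ} (hu : u ≠ 0) :
    (zMap a b c u).im = constA a b c * (u.im * curveForm a b u / normSq u ^ 3) := by
  have hn : normSq u ≠ 0 := by simpa using hu
  have h : zMap a b c u = ((constA a b c : ℝ) : ℂ) * (u + ((a ^ 2 + b ^ 2 : ℝ) : ℂ) * u⁻¹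
      - ((a ^ 2 * b ^ 2 / 3 : ℝ) : ℂ) * u⁻¹ ^ 3) := by
    simp only [zMap]
    push_cast
    field_simp
  have hi : u⁻¹ = ((normSq u)⁻¹ : ℝ) * conj u := by
    rw [Complex.inv_def, mul_comm]
  have hn2 : normSq u = u.re ^ 2 + u.im ^ 2 := by rw [normSq_apply]; ring
  rw [h, hi, im_ofReal_mul]
  congr 1
  rw [sub_im, add_im, im_ofReal_mul, im_ofReal_mul, im_ofReal_mul, mul_pow, ← ofReal_pow,
    im_ofReal_mul, conj_im]
  -- With |u|² kept as a variable, the cubic term contributes only Im u times a polynomial in (Im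
  -- u)² and |u|².
  have h3 : (conj u ^ 3).im = u.im * (4 * u.im ^ 2 - 3 * normSq u) := by
    rw [hn2]
    simp [pow_succ, mul_re, mul_im]
    ring
  rw [h3, curveForm]
  field_simp
  ring

theorem yMap_im (a b c : ℝ) {u : ℂ} (hu : u ≠ 0) :
    (yMap a b c u).im = -(constA a c b * (u.im / normSq u) * densityForm a c u) := by
  have hn : normSq u ≠ 0 := by simpa using hu
  rw [yMap, zMap_im _ _ _ (inv_ne_zero hu)]
  simp only [curveForm, densityForm, Complex.inv_im, map_inv₀]
  field_simp

theorem den_pos {a b c : ℝ} (ha : 1 < a) : 0 < den a b c := by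
  have : 1 < a ^ 4 := one_lt_pow₀ ha (by norm_num)
  have h : den a b c = 3 * (a ^ 4 - 1) + ((a ^ 2 * b * c) ^ 2 + 3 * (a * b) ^ 2 + 3 * (a * c) ^ 2
    + 3 * (b * c) ^ 2) := by rw [den]; ring
  rw [h]
  have : 0 < 3 * (a ^ 4 - 1) := by linarith
  positivity

theorem constA_pos {a b c : ℝ} (ha : 1 < a) : 0 < constA a b c := by
  have := den_pos (b := b) (c := c) ha
  rw [constA]
  have : 0 < a := by linarith
  positivity

/-- The cleared form stays continuous at u = 0, so it survives passage to limits that X itself would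
not. -/
theorem zMap_eq_iff {a b c : ℝ} {u z : ℂ} (hu : u ≠ 0) : zMap a b c u = z ↔
    constA a b c * (u ^ 4 + (a ^ 2 + b ^ 2) * u ^ 2 - a ^ 2 * b ^ 2 / 3) = z * u ^ 3 := by
  have h : constA a b c * (u ^ 4 + (a ^ 2 + b ^ 2) * u ^ 2 - a ^ 2 * b ^ 2 / 3)
      = zMap a b c u * u ^ 3 := by
    rw [zMap]; field_simp
  rw [h, mul_left_inj' (pow_ne_zero 3 hu)]

theorem card_preimage_le {a b c : ℝ} (hA : 0 < constA a b c) (z : ℂ) (s : Finset ℂ)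
    (hs : ∀ u ∈ s, u ≠ 0 ∧ zMap a b c u = z) : s.card ≤ 4 := by
  classical
  let A : ℂ := constA a b c
  have hA' : A ≠ 0 := by simpa [A] using hA.ne'
  let p : Polynomial ℂ := Polynomial.C A * Polynomial.X ^ 4 + Polynomial.C (-z) * Polynomial.X ^ 3
    + Polynomial.C (A * (a ^ 2 + b ^ 2)) * Polynomial.X ^ 2 + Polynomial.C (-(A * (a ^ 2 * b ^ 2 / 3)))
  have hc : p.coeff 4 = A := by
    simp [p, Polynomial.coeff_X_pow, -map_neg, -map_mul]
  have hp : p ≠ 0 := by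
    intro h0
    rw [h0] at hc
    exact hA' (by simpa using hc.symm)
  have hd : p.natDegree ≤ 4 := by
    simp only [p]; compute_degree
  have : s ⊆ p.roots.toFinset := by
    intro u hu
    obtain ⟨h0, h1⟩ := hs u hu
    rw [zMap_eq_iff h0] at h1
    rw [Multiset.mem_toFinset, Polynomial.mem_roots hp, Polynomial.IsRoot]
    simp only [p, Polynomial.eval_add, Polynomial.eval_mul, Polynomial.eval_C, Polynomial.eval_pow,
      Polynomial.eval_X]
    linear_combination h1
  calc s.card ≤ p.roots.toFinset.card := Finset.card_le_card this
    _ ≤ p.roots.card := p.roots.toFinset_card_le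
    _ ≤ p.natDegree := p.card_roots'
    _ ≤ 4 := hd

/-! ### The sheet regions as polynomial inequalities. -/

/-- Both radii in terms of one square root. -/
theorem exists_radii {a b : ℝ} (hb : 0 < b) (hab : b < a) (u : ℂ) (hu : u ≠ 0) :
    ∃ K : ℝ, 0 < K ∧ rPlus a b u.arg = √((a ^ 2 + b ^ 2) / 2 + K) ∧
      rMinus a b u.arg = √((a ^ 2 + b ^ 2) / 2 - K) ∧
      curveForm a b u = normSq u * ((normSq u - (a ^ 2 + b ^ 2) / 2) ^ 2 - K ^ 2) := by
  have hn : normSq u ≠ 0 := by simpa using hu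
  have h2 : 0 < a ^ 2 - b ^ 2 := by nlinarith
  have h3 : 0 < 4 / 3 * a ^ 2 * b ^ 2 * Real.sin u.arg ^ 2 + (a ^ 2 - b ^ 2) ^ 2 / 4 := by
    positivity
  refine ⟨_, Real.sqrt_pos.2 h3, rfl, rfl, ?_⟩
  rw [Real.sq_sqrt h3.le, Complex.sin_arg, div_pow, ← Complex.normSq_eq_norm_sq, curveForm]
  field_simp
  ring

theorem sq_lt_sq_cases {x K : ℝ} (hK : 0 < K) : 0 < x ^ 2 - K ^ 2 ↔ K < x ∨ x < -K := by
  rw [sub_pos, sq_lt_sq, abs_of_pos hK, lt_abs]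
  constructor <;> rintro (h | h) <;> [left; right; left; right] <;> linarith

theorem mem_sheetRegion_one {a b : ℝ} (hb : 0 < b) (hab : b < a) (u : ℂ) :
    u ∈ sheetRegion a b .one ↔ 0 < curveForm a b u ∧ a ^ 2 + b ^ 2 < 2 * normSq u := by
  have hq : 0 < a ^ 2 + b ^ 2 := by positivity
  change rPlus a b u.arg < ‖u‖ ↔ _
  rcases eq_or_ne u 0 with rfl | hu
  · simp only [norm_zero, map_zero, mul_zero]
    exact ⟨fun h => absurd h (not_lt.2 (Real.sqrt_nonneg _)), fun h => absurd h.2 (not_lt.2 hq.le)⟩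
  obtain ⟨K, hK, h1, -, h3⟩ := exists_radii hb hab u hu
  have hn : 0 < normSq u := by simpa using hu
  rw [h1, h3, mul_pos_iff_of_pos_left hn, Real.sqrt_lt' (by simpa using hu), ← normSq_eq_norm_sq,
    sq_lt_sq_cases hK]
  constructor
  · intro h; exact ⟨Or.inl (by linarith), by linarith⟩
  · rintro ⟨h | h, h'⟩ <;> linarith

theorem mem_sheetRegion_two {a b : ℝ} (hb : 0 < b) (hab : b < a) (u : ℂ) :
    u ∈ sheetRegion a b .two ↔ curveForm a b u < 0 := by
  change rMinus a b u.arg < ‖u‖ ∧ ‖u‖ < rPlus a b u.arg ↔ _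
  rcases eq_or_ne u 0 with rfl | hu
  · simp only [norm_zero]
    refine ⟨fun h => absurd h.1 (not_lt.2 (Real.sqrt_nonneg _)), fun h => ?_⟩
    simp [curveForm] at h
  obtain ⟨K, hK, h1, h2, h3⟩ := exists_radii hb hab u hu
  have hn : 0 < normSq u := by simpa using hu
  rw [h1, h2, h3, Real.sqrt_lt' (by simpa using hu), Real.lt_sqrt (norm_nonneg _),
    ← normSq_eq_norm_sq, mul_neg_iff]
  constructor
  · rintro ⟨h, h'⟩; exact Or.inl ⟨hn, by nlinarith⟩
  · rintro (⟨-, h⟩ | ⟨h, -⟩)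
    · have := abs_lt_of_sq_lt_sq (sub_neg.1 h) hK.le
      rw [abs_lt] at this
      constructor <;> linarith [this.1, this.2]
    · linarith

/-- The convention √x = 0 for x ≤ 0 does the right thing: in directions without an inner curve both
sides are false. -/
theorem norm_lt_rMinus_iff {a b : ℝ} (hb : 0 < b) (hab : b < a) {u : ℂ} (hu : u ≠ 0) :
    ‖u‖ < rMinus a b u.arg ↔ 0 < curveForm a b u ∧ 2 * normSq u < a ^ 2 + b ^ 2 := by
  obtain ⟨K, hK, -, h2, h3⟩ := exists_radii hb hab u hu
  have hn : 0 < normSq u := by simpa using hu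
  rw [h2, h3, mul_pos_iff_of_pos_left hn, Real.lt_sqrt (norm_nonneg _), ← normSq_eq_norm_sq,
    sq_lt_sq_cases hK]
  constructor
  · intro h; exact ⟨Or.inr (by linarith), by linarith⟩
  · rintro ⟨h | h, h'⟩ <;> linarith

theorem mem_sheetRegion_three {a b : ℝ} (hb : 0 < b) (hab : b < a) (u : ℂ) :
    u ∈ sheetRegion a b .three ↔
      (0 < curveForm a b u ∧ 2 * normSq u < a ^ 2 + b ^ 2) ∧ u.re < 0 := by
  change ‖u‖ < rMinus a b u.arg ∧ u.re < 0 ↔ _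
  refine and_congr_left fun h => norm_lt_rMinus_iff hb hab ?_
  rintro rfl
  simp at h

theorem mem_sheetRegion_four {a b : ℝ} (hb : 0 < b) (hab : b < a) (u : ℂ) :
    u ∈ sheetRegion a b .four ↔
      (0 < curveForm a b u ∧ 2 * normSq u < a ^ 2 + b ^ 2) ∧ 0 < u.re := by
  change ‖u‖ < rMinus a b u.arg ∧ 0 < u.re ↔ _
  refine and_congr_left fun h => norm_lt_rMinus_iff hb hab ?_
  rintro rfl
  simp at h

theorem isOpen_sheetRegion {a b : ℝ} (hb : 0 < b) (hab : b < a) (j : Sheet) :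
    IsOpen (sheetRegion a b j) := by
  have hS := continuous_curveForm a b
  have hn := Complex.continuous_normSq
  have hr := Complex.continuous_re
  have h0 : IsOpen {u : ℂ | 0 < curveForm a b u} := isOpen_lt continuous_const hS
  have h1 : IsOpen {u : ℂ | 2 * normSq u < a ^ 2 + b ^ 2} := isOpen_lt (continuous_const.mul hn) continuous_const
  cases j
  · rw [Set.ext (mem_sheetRegion_one hb hab)]
    exact h0.inter (isOpen_lt continuous_const (continuous_const.mul hn))
  · rw [Set.ext (mem_sheetRegion_two hb hab)]
    exact isOpen_lt hS continuous_const
  · rw [Set.ext (mem_sheetRegion_three hb hab)]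
    exact (h0.inter h1).inter (isOpen_lt hr continuous_const)
  · rw [Set.ext (mem_sheetRegion_four hb hab)]
    exact (h0.inter h1).inter (isOpen_lt continuous_const hr)

theorem sheet_eq_of_mem {a b : ℝ} (hb : 0 < b) (hab : b < a) {j k : Sheet} {u : ℂ}
    (hj : u ∈ sheetRegion a b j) (hk : u ∈ sheetRegion a b k) : j = k := by
  cases j <;> cases k <;> first | rfl | (
    simp only [mem_sheetRegion_one hb hab, mem_sheetRegion_two hb hab,
      mem_sheetRegion_three hb hab, mem_sheetRegion_four hb hab] at hj hk
    exfalso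
    linarith [hj, hk])

theorem curveForm_ne_zero_of_mem {a b : ℝ} (hb : 0 < b) (hab : b < a) {j : Sheet} {u : ℂ}
    (hj : u ∈ sheetRegion a b j) : curveForm a b u ≠ 0 := by
  cases j
  · exact ((mem_sheetRegion_one hb hab u).1 hj).1.ne'
  · exact ((mem_sheetRegion_two hb hab u).1 hj).ne
  · exact ((mem_sheetRegion_three hb hab u).1 hj).1.1.ne'
  · exact ((mem_sheetRegion_four hb hab u).1 hj).1.1.ne'

theorem ne_zero_of_mem_sheetRegion {a b : ℝ} (hb : 0 < b) (hab : b < a) {j : Sheet} {u : ℂ}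
    (hj : u ∈ sheetRegion a b j) : u ≠ 0 := by
  rintro rfl
  exact curveForm_ne_zero_of_mem hb hab hj (by simp [curveForm])

theorem conj_mem_sheetRegion {a b : ℝ} (hb : 0 < b) (hab : b < a) {j : Sheet} {u : ℂ} :
    conj u ∈ sheetRegion a b j ↔ u ∈ sheetRegion a b j := by
  cases j <;> simp only [mem_sheetRegion_one hb hab, mem_sheetRegion_two hb hab,
      mem_sheetRegion_three hb hab, mem_sheetRegion_four hb hab, curveForm_conj, normSq_conj,
      conj_re]

/-- The sheet exchanged with the given one by `u ↦ -u`. -/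
def Sheet.neg : Sheet → Sheet
  | .one => .one
  | .two => .two
  | .three => .four
  | .four => .three

theorem neg_mem_sheetRegion {a b : ℝ} (hb : 0 < b) (hab : b < a) {j : Sheet} {u : ℂ} :
    -u ∈ sheetRegion a b j.neg ↔ u ∈ sheetRegion a b j := by
  cases j <;> simp only [Sheet.neg, mem_sheetRegion_one hb hab, mem_sheetRegion_two hb hab,
      mem_sheetRegion_three hb hab, mem_sheetRegion_four hb hab, curveForm_neg, normSq_neg,
      neg_re, Left.neg_neg_iff, Left.neg_pos_iff]

/-- Off the curves, every nonzero point lies in a sheet region. -/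
theorem exists_mem_sheetRegion {a b : ℝ} (hb : 0 < b) (hab : b < a) {u : ℂ}
    (hS : curveForm a b u ≠ 0) : ∃ j, u ∈ sheetRegion a b j := by
  have hn0 : 0 < normSq u := by
    rw [normSq_pos]
    rintro rfl
    exact hS (by simp [curveForm])
  have hP : 0 < a ^ 2 * b ^ 2 := by have := hb.trans hab; positivity
  have hd : 0 < (a ^ 2 - b ^ 2) ^ 2 := by
    have : 0 < a ^ 2 - b ^ 2 := by nlinarith
    positivity
  rcases lt_or_gt_of_ne hS with h | h
  · exact ⟨.two, (mem_sheetRegion_two hb hab u).2 h⟩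
  rcases lt_trichotomy (2 * normSq u) (a ^ 2 + b ^ 2) with h' | h' | h'
  · rcases lt_trichotomy u.re 0 with hr | hr | hr
    · exact ⟨.three, (mem_sheetRegion_three hb hab u).2 ⟨⟨h, h'⟩, hr⟩⟩
    · exfalso
      -- On the imaginary axis S = t(t(t - a² - b²) - a²b²/3) with t = |u|², which is negative for t
      -- < a² + b². So the axis separates the two inner loops.
      have hy : u.im ^ 2 = normSq u := by rw [normSq_apply, hr]; ring
      have h1 : curveForm a b u = normSq u * (normSq u * (normSq u - (a ^ 2 + b ^ 2))
          - a ^ 2 * b ^ 2 / 3) := by rw [curveForm, hy]; ring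
      rw [h1, mul_pos_iff_of_pos_left hn0] at h
      nlinarith
    · exact ⟨.four, (mem_sheetRegion_four hb hab u).2 ⟨⟨h, h'⟩, hr⟩⟩
  · exfalso
    have h1 : curveForm a b u = -(normSq u * ((a ^ 2 - b ^ 2) ^ 2 / 4))
        - 4 / 3 * (a ^ 2 * b ^ 2) * u.im ^ 2 := by
      rw [curveForm, show normSq u = (a ^ 2 + b ^ 2) / 2 by linarith]; ring
    have : 0 ≤ 4 / 3 * (a ^ 2 * b ^ 2) * u.im ^ 2 := by positivity
    have : 0 < normSq u * ((a ^ 2 - b ^ 2) ^ 2 / 4) := by positivity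
    linarith
  · exact ⟨.one, (mem_sheetRegion_one hb hab u).2 ⟨h, h'⟩⟩

/-! ### Local invertibility of X and compactness of its solution sets. -/

theorem curveForm_ne_zero_of_im_ne_zero {a b c : ℝ} {u : ℂ} (hu : u ≠ 0)
    (h : (zMap a b c u).im ≠ 0) : curveForm a b u ≠ 0 := by
  intro h0
  exact h (by rw [zMap_im _ _ _ hu, h0]; simp)

theorem im_eq_zero_of_mem {a b c : ℝ} (ha : 1 < a) (hb : 0 < b) (hab : b < a) {j : Sheet} {u : ℂ}
    (hj : u ∈ sheetRegion a b j) (h : (zMap a b c u).im = 0) : u.im = 0 := by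
  have hu := ne_zero_of_mem_sheetRegion hb hab hj
  have hS := curveForm_ne_zero_of_mem hb hab hj
  have hn : normSq u ≠ 0 := by simpa using hu
  rw [zMap_im _ _ _ hu] at h
  simpa [hS, hn, (constA_pos ha).ne'] using h

/-- The zeros ±a, ±b of X' all lie on S = 0, which the regions avoid. -/
theorem zMapDeriv_ne_zero {a b c : ℝ} (ha : 1 < a) (hb : 0 < b) (hab : b < a) {j : Sheet} {u : ℂ}
    (hj : u ∈ sheetRegion a b j) : zMapDeriv a b c u ≠ 0 := by
  have hu := ne_zero_of_mem_sheetRegion hb hab hj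
  have hS := curveForm_ne_zero_of_mem hb hab hj
  have key : ∀ x : ℝ, (x ^ 2 - a ^ 2) * (x ^ 2 - b ^ 2) = 0 → u ^ 2 - (x : ℂ) ^ 2 ≠ 0 := by
    intro x hx h
    rw [sub_eq_zero, sq_eq_sq_iff_eq_or_eq_neg] at h
    rcases h with h | h
    · exact hS (by rw [h, curveForm_ofReal, hx, mul_zero])
    · exact hS (by rw [h, curveForm_neg, curveForm_ofReal, hx, mul_zero])
  have h1 := key a (by ring)
  have h2 := key b (by ring)
  have h3 : (constA a b c : ℂ) ≠ 0 := by simpa using (constA_pos ha).ne'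
  unfold zMapDeriv
  positivity

theorem zMap_continuousAt (a b c : ℝ) {u : ℂ} (hu : u ≠ 0) : ContinuousAt (zMap a b c) u :=
  (zMap_hasDerivAt a b c hu).continuousAt

theorem zMap_hasStrictDerivAt (a b c : ℝ) {u : ℂ} (hu : u ≠ 0) :
    HasStrictDerivAt (zMap a b c) (zMapDeriv a b c u) u := by
  have h : DifferentiableOn ℂ (zMap a b c) {0}ᶜ := fun v hv =>
    (zMap_hasDerivAt a b c hv).differentiableAt.differentiableWithinAt
  have h2 := (h.analyticAt (isOpen_compl_singleton.mem_nhds hu)).hasStrictDerivAt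
  rwa [(zMap_hasDerivAt a b c hu).deriv] at h2

theorem map_nhds_zMap {a b c : ℝ} (ha : 1 < a) (hb : 0 < b) (hab : b < a) {j : Sheet} {u : ℂ}
    (hj : u ∈ sheetRegion a b j) : map (zMap a b c) (𝓝 u) = 𝓝 (zMap a b c u) :=
  (zMap_hasStrictDerivAt a b c (ne_zero_of_mem_sheetRegion hb hab hj)).map_nhds_eq
    (zMapDeriv_ne_zero ha hb hab hj)

/-- Root bound for the quartic: when |u| > 1, every lower-order term is at most its coefficient
times |u|³. -/
theorem norm_le_of_zMap_eq {a b c : ℝ} (hA : 0 < constA a b c) {u z : ℂ} (hu : u ≠ 0)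
    (h : zMap a b c u = z) :
    ‖u‖ ≤ 1 + ‖z‖ / constA a b c + (a ^ 2 + b ^ 2) + a ^ 2 * b ^ 2 / 3 := by
  have hpos : 0 ≤ ‖z‖ / constA a b c + (a ^ 2 + b ^ 2) + a ^ 2 * b ^ 2 / 3 := by positivity
  rcases le_or_gt ‖u‖ 1 with h1 | h1
  · linarith
  have hA' : (constA a b c : ℂ) ≠ 0 := by simpa using hA.ne'
  rw [zMap_eq_iff hu] at h
  have e : u ^ 4 = z / constA a b c * u ^ 3 - ((a ^ 2 + b ^ 2 : ℝ) : ℂ) * u ^ 2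
      + ((a ^ 2 * b ^ 2 / 3 : ℝ) : ℂ) := by
    push_cast
    field_simp
    linear_combination 3 * h
  have h3 : ‖u‖ ^ 4 ≤ ‖z‖ / constA a b c * ‖u‖ ^ 3 + (a ^ 2 + b ^ 2) * ‖u‖ ^ 2
      + a ^ 2 * b ^ 2 / 3 := by
    calc ‖u‖ ^ 4 = ‖u ^ 4‖ := (norm_pow u 4).symm
      _ ≤ ‖z / constA a b c * u ^ 3‖ + ‖((a ^ 2 + b ^ 2 : ℝ) : ℂ) * u ^ 2‖
          + ‖((a ^ 2 * b ^ 2 / 3 : ℝ) : ℂ)‖ := by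
          rw [e]; exact (norm_add_le _ _).trans (by gcongr; exact norm_sub_le _ _)
      _ = _ := by
          rw [norm_mul, norm_mul, norm_div, norm_pow, norm_pow, norm_real, norm_real, norm_real,
            Real.norm_of_nonneg hA.le, Real.norm_of_nonneg (by positivity : 0 ≤ a ^ 2 + b ^ 2),
            Real.norm_of_nonneg (by positivity : 0 ≤ a ^ 2 * b ^ 2 / 3)]
  set r := ‖u‖
  have hr3 : 0 < r ^ 3 := by positivity
  have h5 : (a ^ 2 + b ^ 2) * r ^ 2 ≤ (a ^ 2 + b ^ 2) * r ^ 3 := by gcongr <;> norm_num; linarith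
  have h6 : a ^ 2 * b ^ 2 / 3 * 1 ≤ a ^ 2 * b ^ 2 / 3 * r ^ 3 := by
    gcongr; exact one_le_pow₀ h1.le
  have : r * r ^ 3 ≤ (‖z‖ / constA a b c + (a ^ 2 + b ^ 2) + a ^ 2 * b ^ 2 / 3) * r ^ 3 := by
    calc r * r ^ 3 = r ^ 4 := by ring
      _ ≤ _ := h3
      _ ≤ _ := by linarith
  have := le_of_mul_le_mul_right this hr3
  linarith

/-- Limits of solutions of `zMap u = z` are solutions; in particular they do not vanish. -/
theorem zMap_eq_of_tendsto {a b c : ℝ} (hA : 0 < constA a b c) (ha : 0 < a) (hb : 0 < b)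
    {ι : Type*} {l : Filter ι} [l.NeBot] {u z : ι → ℂ} {u' z' : ℂ} (hu : Tendsto u l (𝓝 u'))
    (hz : Tendsto z l (𝓝 z')) (h0 : ∀ n, u n ≠ 0) (h : ∀ n, zMap a b c (u n) = z n) :
    u' ≠ 0 ∧ zMap a b c u' = z' := by
  have e : constA a b c * (u' ^ 4 + (a ^ 2 + b ^ 2) * u' ^ 2 - a ^ 2 * b ^ 2 / 3) = z' * u' ^ 3 := by
    refine tendsto_nhds_unique (f := fun n => z n * u n ^ 3) ?_ (hz.mul (hu.pow 3))
    refine Tendsto.congr (fun n => (zMap_eq_iff (h0 n)).1 (h n)) ?_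
    exact (((hu.pow 4).add ((hu.pow 2).const_mul _)).sub_const _).const_mul _
  -- At u' = 0 the limiting equation would read -A a²b²/3 = 0.
  have h0' : u' ≠ 0 := by
    rintro rfl
    have hA' : (constA a b c : ℂ) ≠ 0 := by simpa using hA.ne'
    have : (a : ℂ) ≠ 0 := by simpa using ha.ne'
    have : (b : ℂ) ≠ 0 := by simpa using hb.ne'
    simp_all
  exact ⟨h0', (zMap_eq_iff h0').2 e⟩

/-- Solutions over a convergent sequence have a convergent subsequence. -/
theorem exists_subseq_tendsto {a b c : ℝ} (hA : 0 < constA a b c) {u z : ℕ → ℂ} {z' : ℂ}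
    (hz : Tendsto z atTop (𝓝 z')) (h0 : ∀ n, u n ≠ 0) (h : ∀ n, zMap a b c (u n) = z n) :
    ∃ (u' : ℂ) (φ : ℕ → ℕ), StrictMono φ ∧ Tendsto (u ∘ φ) atTop (𝓝 u') := by
  obtain ⟨R, hR⟩ := isBounded_iff_forall_norm_le.1 (Metric.isBounded_range_of_tendsto z hz)
  have hb : Bornology.IsBounded (Set.range u) := by
    rw [isBounded_iff_forall_norm_le]
    refine ⟨1 + R / constA a b c + (a ^ 2 + b ^ 2) + a ^ 2 * b ^ 2 / 3, ?_⟩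
    rintro _ ⟨n, rfl⟩
    refine (norm_le_of_zMap_eq hA (h0 n) (h n)).trans ?_
    have := hR (z n) ⟨n, rfl⟩
    gcongr
  obtain ⟨u', -, φ, hφ, ht⟩ := tendsto_subseq_of_bounded hb (fun n => Set.mem_range_self n)
  exact ⟨u', φ, hφ, ht⟩

/-! ### Bijectivity of X on each region. -/

theorem exists_mem_sheetRegion_im_pos {a b c : ℝ} (ha : 1 < a) (hb : 0 < b) (hab : b < a)
    (j : Sheet) : ∃ u ∈ sheetRegion a b j, 0 < (zMap a b c u).im := by
  have hq : 0 < a ^ 2 + b ^ 2 := by positivity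
  have hP : 0 < a ^ 2 * b ^ 2 := by positivity
  have hPq : a ^ 2 * b ^ 2 < (a ^ 2 + b ^ 2) ^ 2 := by nlinarith [sq_nonneg (a ^ 2), sq_nonneg (b ^ 2)]
  have key : ∀ u, u ∈ sheetRegion a b j → 0 < u.im * curveForm a b u →
      ∃ u ∈ sheetRegion a b j, 0 < (zMap a b c u).im := by
    intro u hu h
    have h0 := ne_zero_of_mem_sheetRegion hb hab hu
    have hn : 0 < normSq u := by simpa using h0
    refine ⟨u, hu, ?_⟩
    rw [zMap_im _ _ _ h0]
    have := constA_pos (b := b) (c := c) ha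
    positivity
  -- Witnesses for the inner loops: the direction (±2, 1) has sin²θ = 1/5 < 3/4. The choice of k
  -- turns -(a² + b²)|u|⁴ into -(5/2)a²b²k², which is outweighed by (5 - 4/3)a²b²k².
  have key2 : ∀ e k : ℝ, e = 2 ∨ e = -2 → k = √(a ^ 2 * b ^ 2 / (10 * (a ^ 2 + b ^ 2))) →
      0 < k ∧ 0 < curveForm a b ⟨e * k, k⟩ ∧ 2 * normSq ⟨e * k, k⟩ < a ^ 2 + b ^ 2 := by
    intro e k he hk
    have hk2 : k ^ 2 = a ^ 2 * b ^ 2 / (10 * (a ^ 2 + b ^ 2)) := by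
      rw [hk, Real.sq_sqrt (by positivity)]
    have hk3 : k ^ 2 * (10 * (a ^ 2 + b ^ 2)) = a ^ 2 * b ^ 2 := by
      rw [hk2]; field_simp
    have hk0 : 0 < k := by rw [hk]; positivity
    have he2 : e ^ 2 = 4 := by rcases he with rfl | rfl <;> norm_num
    have hn : normSq ⟨e * k, k⟩ = 5 * k ^ 2 := by
      rw [normSq_mk]; linear_combination k ^ 2 * he2
    refine ⟨hk0, ?_, ?_⟩
    · rw [curveForm, hn]
      have : (5 * k ^ 2) ^ 3 - (a ^ 2 + b ^ 2) * (5 * k ^ 2) ^ 2 + a ^ 2 * b ^ 2 * (5 * k ^ 2)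
          - 4 / 3 * a ^ 2 * b ^ 2 * k ^ 2 = k ^ 2 * (125 * k ^ 4 + 7 / 6 * (a ^ 2 * b ^ 2)) := by
        linear_combination (-5 / 2 * k ^ 2) * hk3
      rw [this]; positivity
    · rw [hn]; nlinarith
  cases j
  · have hs : √(2 * (a ^ 2 + b ^ 2)) * √(2 * (a ^ 2 + b ^ 2)) = 2 * (a ^ 2 + b ^ 2) :=
      Real.mul_self_sqrt (by positivity)
    have hS : 0 < curveForm a b ⟨0, √(2 * (a ^ 2 + b ^ 2))⟩ := by
      simp only [curveForm, normSq_mk, sq √_, hs]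
      have := mul_pos hq (sub_pos.2 hPq)
      have : 0 < (a ^ 2 + b ^ 2) ^ 3 := by positivity
      nlinarith
    refine key ⟨0, √(2 * (a ^ 2 + b ^ 2))⟩ ((mem_sheetRegion_one hb hab _).2 ⟨hS, ?_⟩) ?_
    · rw [normSq_mk, hs]; linarith
    · exact mul_pos (by simp only; positivity) hS
  · have hs : √(a ^ 2 + b ^ 2) * √(a ^ 2 + b ^ 2) = a ^ 2 + b ^ 2 :=
      Real.mul_self_sqrt (by positivity)
    -- On sheet 2 the form S is negative, so Im X > 0 requires a point below the real axis.
    have hS : curveForm a b ⟨0, -√(a ^ 2 + b ^ 2)⟩ < 0 := by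
      simp only [curveForm, normSq_mk, neg_sq, sq √_, neg_mul_neg, hs]
      have := mul_pos hq hP
      nlinarith
    refine key ⟨0, -√(a ^ 2 + b ^ 2)⟩ ((mem_sheetRegion_two hb hab _).2 hS) ?_
    exact mul_pos_of_neg_of_neg (by simp only [neg_lt_zero]; positivity) hS
  · obtain ⟨h1, h2, h3⟩ := key2 (-2) _ (Or.inr rfl) rfl
    exact key _ ((mem_sheetRegion_three hb hab _).2 ⟨⟨h2, h3⟩, by simp only; linarith⟩)
      (mul_pos h1 h2)
  · obtain ⟨h1, h2, h3⟩ := key2 2 _ (Or.inl rfl) rfl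
    exact key _ ((mem_sheetRegion_four hb hab _).2 ⟨⟨h2, h3⟩, by simp only; linarith⟩)
      (mul_pos h1 h2)

/-- A connectedness argument in the half-plane: openness of the image comes from local
invertibility, relative closedness from compactness of solutions. -/
theorem surjOn_of_im_pos {a b c : ℝ} (ha : 1 < a) (hb : 0 < b) (hab : b < a) (j : Sheet) {z : ℂ}
    (hz : 0 < z.im) : ∃ u ∈ sheetRegion a b j, zMap a b c u = z := by
  have hA := constA_pos (b := b) (c := c) ha
  let T : Set ℂ := {z | 0 < z.im ∧ ∃ u ∈ sheetRegion a b j, zMap a b c u = z}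
  have hH : IsPreconnected {z : ℂ | 0 < z.im} := (convex_halfSpace_im_gt 0).isPreconnected
  have hHo : IsOpen {z : ℂ | 0 < z.im} := isOpen_lt continuous_const continuous_im
  have hT : IsOpen T := by
    rw [isOpen_iff_mem_nhds]
    rintro _ ⟨h1, u, hu, rfl⟩
    have h2 : zMap a b c '' sheetRegion a b j ∈ 𝓝 (zMap a b c u) := by
      rw [← map_nhds_zMap ha hb hab hu]
      exact image_mem_map ((isOpen_sheetRegion hb hab j).mem_nhds hu)
    filter_upwards [h2, hHo.mem_nhds h1] with z hz hz'
    exact ⟨hz', hz⟩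
  have hsub : {z : ℂ | 0 < z.im} ⊆ T := by
    refine hH.subset_of_closure_inter_subset hT ?_ ?_
    · obtain ⟨u, hu, h⟩ := exists_mem_sheetRegion_im_pos (c := c) ha hb hab j
      exact ⟨_, h, h, u, hu, rfl⟩
    · rintro w ⟨hw, hw'⟩
      obtain ⟨x, hx, hxw⟩ := mem_closure_iff_seq_limit.1 hw
      choose h1 u hu hux using hx
      have h0 := fun n => ne_zero_of_mem_sheetRegion hb hab (hu n)
      obtain ⟨u', φ, hφ, ht⟩ := exists_subseq_tendsto hA hxw h0 hux
      obtain ⟨h0', he⟩ := zMap_eq_of_tendsto hA (by linarith) hb ht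
        (hxw.comp hφ.tendsto_atTop) (fun n => h0 _) (fun n => hux _)
      have hw0 : (zMap a b c u').im ≠ 0 := by rw [he]; exact hw'.ne'
      -- The limit has a nonreal value, so it is off the curves and lies in some open region. The
      -- regions are disjoint, so that region is the one containing the sequence.
      obtain ⟨k, hk⟩ := exists_mem_sheetRegion hb hab (curveForm_ne_zero_of_im_ne_zero h0' hw0)
      obtain ⟨n, hn⟩ := (ht.eventually ((isOpen_sheetRegion hb hab k).mem_nhds hk)).exists
      obtain rfl := sheet_eq_of_mem hb hab hn (hu _)
      exact ⟨hw', u', hk, he⟩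
  exact (hsub hz).2

theorem surjOn_of_im_ne_zero {a b c : ℝ} (ha : 1 < a) (hb : 0 < b) (hab : b < a) (j : Sheet) {z : ℂ}
    (hz : z.im ≠ 0) : ∃ u ∈ sheetRegion a b j, zMap a b c u = z := by
  rcases lt_or_gt_of_ne hz with h | h
  · obtain ⟨u, hu, he⟩ := surjOn_of_im_pos (c := c) ha hb hab j (z := conj z) (by simpa using h)
    exact ⟨conj u, (conj_mem_sheetRegion hb hab).2 hu, by rw [zMap_conj, he, conj_conj]⟩
  · exact surjOn_of_im_pos ha hb hab j h

/-- Four solutions in the four regions exhaust all solutions. -/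
theorem injOn_of_im_ne_zero {a b c : ℝ} (ha : 1 < a) (hb : 0 < b) (hab : b < a) {j : Sheet}
    {u v : ℂ} (hu : u ∈ sheetRegion a b j) (hv : v ∈ sheetRegion a b j)
    (h : zMap a b c u = zMap a b c v) (hz : (zMap a b c u).im ≠ 0) : u = v := by
  classical
  by_contra hne
  choose w hw hw' using fun k => surjOn_of_im_ne_zero (c := c) ha hb hab k hz
  obtain ⟨v', hv', hvj, hvz⟩ : ∃ v', v' ≠ w j ∧ v' ∈ sheetRegion a b j ∧
      zMap a b c v' = zMap a b c u := by
    by_cases hw1 : w j = u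
    · exact ⟨v, fun h' => hne (by rw [h', hw1]), hv, h.symm⟩
    · exact ⟨u, fun h' => hw1 h'.symm, hu, rfl⟩
  have hww : ∀ k l, w k = w l → k = l := fun k l hkl =>
    sheet_eq_of_mem hb hab (hw k) (hkl ▸ hw l)
  have hvw : ∀ k, v' ≠ w k := by
    intro k hk
    obtain rfl := sheet_eq_of_mem hb hab hvj (hk ▸ hw k)
    exact hv' hk
  have hcard : ({v', w .one, w .two, w .three, w .four} : Finset ℂ).card = 5 := by
    have hne : ∀ k l, k ≠ l → w k ≠ w l := fun k l hkl h' => hkl (hww k l h')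
    rw [Finset.card_insert_of_notMem, Finset.card_insert_of_notMem, Finset.card_insert_of_notMem,
      Finset.card_insert_of_notMem, Finset.card_singleton] <;> simp [hvw, hne]
  have := card_preimage_le (constA_pos (b := b) (c := c) ha) (zMap a b c u)
    {v', w .one, w .two, w .three, w .four} (by
      have h0 := fun k => ne_zero_of_mem_sheetRegion hb hab (hw k)
      have h0' := ne_zero_of_mem_sheetRegion hb hab hvj
      simp [h0, h0', hw', hvz])
  omega

/-- Two distinct points with the same value have disjoint neighbourhoods whose images both contain a
neighbourhood of that value. They would share a nonreal value, where injectivity is already known.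
-/
theorem injOn_zMap {a b c : ℝ} (ha : 1 < a) (hb : 0 < b) (hab : b < a) (j : Sheet) :
    Set.InjOn (zMap a b c) (sheetRegion a b j) := by
  intro u hu v hv h
  by_contra hne
  obtain ⟨s, t, hs, ht, hus, hvt, hd⟩ := t2_separation hne
  have hU := isOpen_sheetRegion hb hab j
  have h1 : zMap a b c '' (s ∩ sheetRegion a b j) ∈ 𝓝 (zMap a b c u) := by
    rw [← map_nhds_zMap ha hb hab hu]
    exact image_mem_map ((hs.inter hU).mem_nhds ⟨hus, hu⟩)
  have h2 : zMap a b c '' (t ∩ sheetRegion a b j) ∈ 𝓝 (zMap a b c u) := by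
    rw [h, ← map_nhds_zMap ha hb hab hv]
    exact image_mem_map ((ht.inter hU).mem_nhds ⟨hvt, hv⟩)
  have h3 : Dense {z : ℂ | z.im ≠ 0} := by
    have : IsOpenMap Complex.im := Complex.isOpenMap_im
    exact (dense_compl_singleton (0 : ℝ)).preimage this
  obtain ⟨z, hz, ⟨x, hx, hxz⟩, ⟨y, hy, rfl⟩⟩ :=
    h3.inter_nhds_nonempty (inter_mem h1 h2)
  have := injOn_of_im_ne_zero ha hb hab hx.2 hy.2 hxz (by rw [hxz]; exact hz)
  exact Set.disjoint_left.1 hd hx.1 (this ▸ hy.1)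

/-! ### X on the real axis and the cuts. -/

theorem zMap_ofReal_re (a b c x : ℝ) : (zMap a b c x).re =
    constA a b c * (x + (a ^ 2 + b ^ 2) / x - a ^ 2 * b ^ 2 / (3 * x ^ 3)) := by
  rw [zMap_ofReal, ofReal_re]

theorem zMap_ofReal_eq (a b c x : ℝ) : zMap a b c x = ((zMap a b c x).re : ℂ) := by
  rw [zMap_ofReal, ofReal_re]

/-- The double factor at x = b reflects X'(b) = 0; only the sign of the quadratic factor remains to
be decided. -/
theorem zMap_sub_beta {a b c x : ℝ} (hb : 0 < b) (hx : x ≠ 0) : (zMap a b c x).re - beta a b c =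
    constA a b c * ((x - b) ^ 2 * (x ^ 2 - 2 * a ^ 2 / (3 * b) * x - a ^ 2 / 3) / x ^ 3) := by
  rw [beta, zMap_ofReal_re, zMap_ofReal_re]
  field_simp
  ring

theorem zMap_sub_alpha {a b c x : ℝ} (ha : 0 < a) (hx : x ≠ 0) : (zMap a b c x).re - alpha a b c =
    constA a b c * ((x - a) ^ 2 * (x ^ 2 - 2 * b ^ 2 / (3 * a) * x - b ^ 2 / 3) / x ^ 3) := by
  rw [alpha, zMap_ofReal_re, zMap_ofReal_re]
  field_simp
  ring

theorem alpha_pos {a b c : ℝ} (ha : 1 < a) (hb : 0 < b) : 0 < alpha a b c := by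
  have hA := constA_pos (b := b) (c := c) ha
  have : alpha a b c = constA a b c * (2 * a + 2 / 3 * b ^ 2 / a) := by
    rw [alpha, zMap_ofReal_re]
    have : a ≠ 0 := by linarith
    field_simp
    ring
  rw [this]
  have : 0 < a := by linarith
  positivity

theorem alpha_lt_zMap {a b c x : ℝ} (ha : 1 < a) (hb : 0 < b) (hab : b < a) (hx : b ≤ x)
    (hxa : x ≠ a) : alpha a b c < (zMap a b c x).re := by
  have hA := constA_pos (b := b) (c := c) ha
  have hx0 : 0 < x := by linarith
  have ha0 : 0 < a := by linarith
  rw [← sub_pos, zMap_sub_alpha ha0 hx0.ne']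
  have h1 : 0 < (x - a) ^ 2 := by
    have := sub_ne_zero.2 hxa
    positivity
  -- Regrouped around x = b so that every term is visibly nonnegative for x ≥ b.
  have h2 : x ^ 2 - 2 * b ^ 2 / (3 * a) * x - b ^ 2 / 3
      = (x - b) * (x + b * (1 - 2 * b / (3 * a))) + 2 / 3 * (b ^ 2 * (1 - b / a)) := by
    field_simp
    ring
  have h3 : 0 < 1 - b / a := by rw [sub_pos, div_lt_one ha0]; exact hab
  have h4 : 0 < 1 - 2 * b / (3 * a) := by rw [sub_pos, div_lt_one (by positivity)]; linarith
  have h5 := sub_nonneg.2 hx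
  have h6 := sub_pos.2 hab
  have : 0 < x ^ 2 - 2 * b ^ 2 / (3 * a) * x - b ^ 2 / 3 := by
    rw [h2]; positivity
  positivity

theorem zMap_lt_beta {a b c x : ℝ} (ha : 1 < a) (hb : 0 < b) (hab : b < a) (hx : 0 < x)
    (hxa : x ≤ a) (hxb : x ≠ b) : (zMap a b c x).re < beta a b c := by
  have hA := constA_pos (b := b) (c := c) ha
  have ha0 : 0 < a := by linarith
  rw [← sub_neg, zMap_sub_beta hb hx.ne']
  have h1 : 0 < (x - b) ^ 2 := by
    have := sub_ne_zero.2 hxb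
    positivity
  have h2 : x ^ 2 - 2 * a ^ 2 / (3 * b) * x - a ^ 2 / 3
      = -((a - x) * x + a ^ 2 / 3 + a / (3 * b) * x * (2 * (a - b)) - a * x / 3) := by
    field_simp
    ring
  have h3 : 0 < (a - x) * x + a ^ 2 / 3 + a / (3 * b) * x * (2 * (a - b)) - a * x / 3 := by
    have h6 := sub_pos.2 hab
    have h5 := sub_nonneg.2 hxa
    have : a ^ 2 / 3 - a * x / 3 = a / 3 * (a - x) := by ring
    have h7 : 0 < a / (3 * b) * x * (2 * (a - b)) := by positivity
    have h8 : 0 ≤ (a - x) * x := by positivity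
    have h9 : 0 ≤ a / 3 * (a - x) := by positivity
    linarith
  have h4 : 0 < constA a b c * ((x - b) ^ 2 *
      ((a - x) * x + a ^ 2 / 3 + a / (3 * b) * x * (2 * (a - b)) - a * x / 3) / x ^ 3) := by
    positivity
  rw [h2]
  have h5 : ∀ A B C D : ℝ, A * (B * -C / D) = -(A * (B * C / D)) := fun A B C D => by ring
  rw [h5]
  linarith

theorem alpha_lt_beta {a b c : ℝ} (ha : 1 < a) (hb : 0 < b) (hab : b < a) :
    alpha a b c < beta a b c :=
  alpha_lt_zMap ha hb hab le_rfl hab.ne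

theorem re_zMap_neg (a b c x : ℝ) : (zMap a b c (-x : ℝ)).re = -(zMap a b c x).re := by
  rw [ofReal_neg, zMap_neg, neg_re]

theorem mem_one_ofReal {a b x : ℝ} (hb : 0 < b) (hab : b < a) :
    (x : ℂ) ∈ sheetRegion a b .one ↔ a < |x| := by
  have h1 : b ^ 2 < a ^ 2 := by nlinarith
  rw [mem_sheetRegion_one hb hab, curveForm_ofReal, normSq_ofReal, ← sq, ← abs_of_pos (hb.trans hab),
    ← sq_lt_sq, abs_of_pos (hb.trans hab)]
  constructor
  · rintro ⟨h2, h3⟩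
    by_contra! h4
    have : 0 < x ^ 2 - b ^ 2 := by linarith
    have : (x ^ 2 - a ^ 2) * (x ^ 2 - b ^ 2) ≤ 0 := mul_nonpos_of_nonpos_of_nonneg (by linarith) this.le
    nlinarith [sq_nonneg x]
  · intro h
    have h2 : 0 < x ^ 2 - a ^ 2 := by linarith
    have h3 : 0 < x ^ 2 - b ^ 2 := by linarith
    have h4 : 0 < x ^ 2 := by nlinarith
    exact ⟨by positivity, by linarith⟩

theorem mem_two_ofReal {a b x : ℝ} (hb : 0 < b) (hab : b < a) :
    (x : ℂ) ∈ sheetRegion a b .two ↔ b < |x| ∧ |x| < a := by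
  have h1 : b ^ 2 < a ^ 2 := by nlinarith
  have e1 : b < |x| ↔ b ^ 2 < x ^ 2 := by rw [sq_lt_sq, abs_of_pos hb]
  have e2 : |x| < a ↔ x ^ 2 < a ^ 2 := by rw [sq_lt_sq, abs_of_pos (hb.trans hab)]
  rw [mem_sheetRegion_two hb hab, curveForm_ofReal, e1, e2]
  constructor
  · intro h
    have h2 : (x ^ 2 - a ^ 2) * (x ^ 2 - b ^ 2) < 0 := by
      by_contra! h3
      have := mul_nonneg (sq_nonneg x) h3
      linarith
    rcases mul_neg_iff.1 h2 with h | h <;> constructor <;> linarith [h.1, h.2]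
  · rintro ⟨h2, h3⟩
    have h4 : 0 < x ^ 2 := by nlinarith
    exact mul_neg_of_pos_of_neg h4 (mul_neg_of_neg_of_pos (by linarith) (by linarith))

theorem inner_ofReal {a b x : ℝ} (hb : 0 < b) (hab : b < a) :
    (0 < curveForm a b x ∧ 2 * normSq (x : ℂ) < a ^ 2 + b ^ 2) ↔ x ≠ 0 ∧ |x| < b := by
  have h1 : b ^ 2 < a ^ 2 := by nlinarith
  have e1 : |x| < b ↔ x ^ 2 < b ^ 2 := by rw [sq_lt_sq, abs_of_pos hb]
  rw [curveForm_ofReal, normSq_ofReal, ← sq, e1]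
  constructor
  · rintro ⟨h2, h3⟩
    have h0 : x ≠ 0 := by rintro rfl; simp at h2
    refine ⟨h0, ?_⟩
    by_contra! h4
    have h5 : x ^ 2 - a ^ 2 < 0 := by linarith
    have : (x ^ 2 - a ^ 2) * (x ^ 2 - b ^ 2) ≤ 0 := mul_nonpos_of_nonpos_of_nonneg h5.le (by linarith)
    nlinarith [sq_nonneg x]
  · rintro ⟨h0, h⟩
    have h4 : 0 < x ^ 2 := by positivity
    exact ⟨mul_pos h4 (mul_pos_of_neg_of_neg (by linarith) (by linarith)), by linarith⟩

theorem mem_three_ofReal {a b x : ℝ} (hb : 0 < b) (hab : b < a) :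
    (x : ℂ) ∈ sheetRegion a b .three ↔ -b < x ∧ x < 0 := by
  rw [mem_sheetRegion_three hb hab, inner_ofReal hb hab, ofReal_re, abs_lt]
  exact ⟨fun h => ⟨h.1.2.1, h.2⟩, fun h => ⟨⟨h.2.ne, h.1, by linarith [h.2]⟩, h.2⟩⟩

theorem mem_four_ofReal {a b x : ℝ} (hb : 0 < b) (hab : b < a) :
    (x : ℂ) ∈ sheetRegion a b .four ↔ 0 < x ∧ x < b := by
  rw [mem_sheetRegion_four hb hab, inner_ofReal hb hab, ofReal_re, abs_lt]
  exact ⟨fun h => ⟨h.2, h.1.2.2⟩, fun h => ⟨⟨h.1.ne', by linarith [h.1], h.2⟩, h.1⟩⟩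

theorem re_notMem_cut_of_abs {a b c x : ℝ} (ha : 1 < a) (hb : 0 < b) (hab : b < a) :
    (a < |x| → alpha a b c < |(zMap a b c x).re|) ∧
    (b < |x| → |x| < a → alpha a b c < |(zMap a b c x).re| ∧ |(zMap a b c x).re| < beta a b c) := by
  have hp := alpha_pos (c := c) ha hb
  have key : |(zMap a b c x).re| = |(zMap a b c (|x| : ℝ)).re| := by
    rcases abs_choice x with h | h <;> rw [h]
    rw [re_zMap_neg, abs_neg]
  rw [key]
  constructor
  · intro h
    have := alpha_lt_zMap (c := c) ha hb hab (hab.trans h).le h.ne'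
    rwa [abs_of_pos (hp.trans this)]
  · intro h1 h2
    have := alpha_lt_zMap (c := c) ha hb hab h1.le h2.ne
    rw [abs_of_pos (hp.trans this)]
    exact ⟨this, zMap_lt_beta ha hb hab (hb.trans h1) h2.le h1.ne'⟩

theorem mapsTo_zMap {a b c : ℝ} (ha : 1 < a) (hb : 0 < b) (hab : b < a) (j : Sheet) :
    Set.MapsTo (zMap a b c) (sheetRegion a b j) (sheetCut a b c j)ᶜ := by
  intro u hu hz
  have him : (zMap a b c u).im = 0 := by cases j <;> exact hz.1
  obtain ⟨x, rfl⟩ : ∃ x : ℝ, u = x := ⟨u.re, Complex.ext rfl (by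
    simpa using im_eq_zero_of_mem ha hb hab hu him)⟩
  obtain ⟨h1, h2⟩ := re_notMem_cut_of_abs (c := c) (x := x) ha hb hab
  cases j
  · exact absurd hz.2 (not_le.2 (h1 ((mem_one_ofReal hb hab).1 hu)))
  · have h3 := (mem_two_ofReal hb hab).1 hu
    obtain ⟨h4, h5⟩ := h2 h3.1 h3.2
    rcases hz.2 with h | h <;> linarith
  · have h3 := (mem_three_ofReal hb hab).1 hu
    have h4 : (zMap a b c x).re ≤ -beta a b c := hz.2
    have := zMap_lt_beta (c := c) (x := -x) ha hb hab (by linarith) (by linarith) (by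
      intro h; linarith)
    rw [re_zMap_neg] at this
    linarith
  · have h3 := (mem_four_ofReal hb hab).1 hu
    have h4 : beta a b c ≤ (zMap a b c x).re := hz.2
    have := zMap_lt_beta (c := c) ha hb hab h3.1 (by linarith) h3.2.ne
    linarith

/-- The quartic whose nonzero roots are the real solutions of `zMap u = s`. -/
theorem quartic_eq {a b c x s : ℝ} (hx : x ≠ 0) :
    constA a b c * (x ^ 4 + (a ^ 2 + b ^ 2) * x ^ 2 - a ^ 2 * b ^ 2 / 3) - s * x ^ 3
      = x ^ 3 * ((zMap a b c x).re - s) := by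
  rw [zMap_ofReal_re]
  field_simp

theorem exists_root_one {a b c s : ℝ} (ha : 1 < a) (hb : 0 < b)
    (hs : alpha a b c < s) : ∃ x : ℝ, a < x ∧ (zMap a b c x).re = s := by
  have hA := constA_pos (b := b) (c := c) ha
  -- The bound s ≤ A M lets the leading term A M⁴ absorb s M³, so the quartic is positive at M.
  set M := max (a + 1) (s / constA a b c)
  have hM : a + 1 ≤ M := le_max_left _ _
  have hM2 : s ≤ constA a b c * M := by
    have : s / constA a b c ≤ M := le_max_right _ _
    rwa [div_le_iff₀ hA, mul_comm] at this
  have hM0 : 0 < M := by linarith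
  have hcont : ContinuousOn (fun x : ℝ => constA a b c * (x ^ 4 + (a ^ 2 + b ^ 2) * x ^ 2
      - a ^ 2 * b ^ 2 / 3) - s * x ^ 3) (Set.Icc a M) := by fun_prop
  have h1 : constA a b c * (a ^ 4 + (a ^ 2 + b ^ 2) * a ^ 2 - a ^ 2 * b ^ 2 / 3) - s * a ^ 3 < 0 := by
    rw [quartic_eq (by linarith)]
    exact mul_neg_of_pos_of_neg (by positivity) (by rw [← alpha]; linarith)
  have h2 : 0 < constA a b c * (M ^ 4 + (a ^ 2 + b ^ 2) * M ^ 2 - a ^ 2 * b ^ 2 / 3) - s * M ^ 3 := by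
    have h3 : s * M ^ 3 ≤ constA a b c * M * M ^ 3 := by gcongr
    have h4 : 0 < (a ^ 2 + b ^ 2) * M ^ 2 - a ^ 2 * b ^ 2 / 3 := by
      have : a ^ 2 ≤ M ^ 2 := by gcongr; linarith
      have h6 : a ^ 2 * b ^ 2 ≤ M ^ 2 * b ^ 2 := by gcongr
      have h7 : 0 < M ^ 2 * b ^ 2 := by positivity
      have h8 : 0 < M ^ 2 * a ^ 2 := by positivity
      nlinarith
    have h5 := mul_pos hA h4
    nlinarith
  obtain ⟨x, hx, hx0⟩ := intermediate_value_Ioo (by linarith) hcont ⟨h1, h2⟩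
  refine ⟨x, hx.1, ?_⟩
  have hx1 : x ≠ 0 := by linarith [hx.1]
  simp only [quartic_eq hx1] at hx0
  have := (mul_eq_zero.1 hx0).resolve_left (pow_ne_zero 3 hx1)
  linarith

theorem exists_root_two {a b c s : ℝ} (hb : 0 < b) (hab : b < a)
    (hs : alpha a b c < s) (hs' : s < beta a b c) :
    ∃ x : ℝ, b < x ∧ x < a ∧ (zMap a b c x).re = s := by
  have hcont : ContinuousOn (fun x : ℝ => (zMap a b c x).re) (Set.Icc b a) := by
    intro x hx
    have h0 : (x : ℂ) ≠ 0 := by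
      have : x ≠ 0 := by linarith [hx.1]
      exact_mod_cast this
    exact (Complex.continuous_re.continuousAt.comp ((zMap_continuousAt a b c h0).comp
      Complex.continuous_ofReal.continuousAt)).continuousWithinAt
  obtain ⟨x, hx, hx0⟩ := intermediate_value_Ioo' hab.le hcont ⟨hs, hs'⟩
  exact ⟨x, hx.1, hx.2, hx0⟩

theorem exists_root_four {a b c s : ℝ} (ha : 1 < a) (hb : 0 < b)
    (hs : s < beta a b c) : ∃ x : ℝ, 0 < x ∧ x < b ∧ (zMap a b c x).re = s := by
  have hA := constA_pos (b := b) (c := c) ha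
  -- X has a pole at 0, whereas the quartic is continuous on all of [0, b] and negative at 0.
  have hcont : ContinuousOn (fun x : ℝ => constA a b c * (x ^ 4 + (a ^ 2 + b ^ 2) * x ^ 2
      - a ^ 2 * b ^ 2 / 3) - s * x ^ 3) (Set.Icc 0 b) := by fun_prop
  have h1 : constA a b c * ((0 : ℝ) ^ 4 + (a ^ 2 + b ^ 2) * 0 ^ 2 - a ^ 2 * b ^ 2 / 3)
      - s * 0 ^ 3 < 0 := by
    have : 0 < constA a b c * (a ^ 2 * b ^ 2 / 3) := by positivity
    linarith
  have h2 : 0 < constA a b c * (b ^ 4 + (a ^ 2 + b ^ 2) * b ^ 2 - a ^ 2 * b ^ 2 / 3) - s * b ^ 3 := by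
    rw [quartic_eq hb.ne']
    exact mul_pos (by positivity) (by rw [← beta]; linarith)
  obtain ⟨x, hx, hx0⟩ := intermediate_value_Ioo hb.le hcont ⟨h1, h2⟩
  refine ⟨x, hx.1, hx.2, ?_⟩
  have hx1 : x ≠ 0 := hx.1.ne'
  simp only [quartic_eq hx1] at hx0
  have := (mul_eq_zero.1 hx0).resolve_left (pow_ne_zero 3 hx1)
  linarith

theorem zMap_eq_of_re {a b c x : ℝ} {z : ℂ} (hz : z.im = 0) (h : (zMap a b c x).re = z.re) :
    zMap a b c x = z := by
  rw [zMap_ofReal_eq, h]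
  exact Complex.ext rfl (by simp [hz])

theorem surjOn_zMap {a b c : ℝ} (ha : 1 < a) (hb : 0 < b) (hab : b < a) (j : Sheet) :
    Set.SurjOn (zMap a b c) (sheetRegion a b j) (sheetCut a b c j)ᶜ := by
  intro z hz
  by_cases him : z.im = 0
  swap
  · obtain ⟨u, hu, h⟩ := surjOn_of_im_ne_zero (c := c) ha hb hab j him
    exact ⟨u, hu, h⟩
  cases j
  · have h1 : alpha a b c < |z.re| := by
      by_contra! h
      exact hz ⟨him, h⟩
    obtain ⟨x, hx, hx'⟩ := exists_root_one ha hb h1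
    rcases abs_choice z.re with h | h
    · exact ⟨x, (mem_one_ofReal hb hab).2 (by rwa [abs_of_pos (by linarith)]),
        zMap_eq_of_re him (by rw [hx', h])⟩
    · exact ⟨((-x : ℝ) : ℂ), (mem_one_ofReal hb hab).2 (by rwa [abs_neg, abs_of_pos (by linarith)]),
        zMap_eq_of_re him (by rw [re_zMap_neg, hx', h, neg_neg])⟩
  · have h1 : alpha a b c < |z.re| := by
      by_contra! h
      exact hz ⟨him, Or.inl h⟩
    have h2 : |z.re| < beta a b c := by
      by_contra! h
      exact hz ⟨him, Or.inr h⟩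
    obtain ⟨x, hx, hxa, hx'⟩ := exists_root_two hb hab h1 h2
    have hx0 : 0 < x := hb.trans hx
    rcases abs_choice z.re with h | h
    · exact ⟨x, (mem_two_ofReal hb hab).2 (by rw [abs_of_pos hx0]; exact ⟨hx, hxa⟩),
        zMap_eq_of_re him (by rw [hx', h])⟩
    · exact ⟨((-x : ℝ) : ℂ), (mem_two_ofReal hb hab).2
        (by rw [abs_neg, abs_of_pos hx0]; exact ⟨hx, hxa⟩),
        zMap_eq_of_re him (by rw [re_zMap_neg, hx', h, neg_neg])⟩
  · have h1 : -z.re < beta a b c := by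
      by_contra! h
      exact hz ⟨him, show z.re ≤ _ by linarith⟩
    obtain ⟨x, hx, hxb, hx'⟩ := exists_root_four ha hb h1
    exact ⟨((-x : ℝ) : ℂ), (mem_three_ofReal hb hab).2 ⟨by linarith, by linarith⟩,
        zMap_eq_of_re him (by rw [re_zMap_neg, hx', neg_neg])⟩
  · have h1 : z.re < beta a b c := by
      by_contra! h
      exact hz ⟨him, h⟩
    obtain ⟨x, hx, hxb, hx'⟩ := exists_root_four ha hb h1
    exact ⟨x, (mem_four_ofReal hb hab).2 ⟨hx, hxb⟩, zMap_eq_of_re him hx'⟩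

/-! ### The inverse maps u_j and the symmetries of φ_j. -/

theorem bijOn_zMap {a b c : ℝ} (ha : 1 < a) (hb : 0 < b) (hab : b < a) (j : Sheet) :
    Set.BijOn (zMap a b c) (sheetRegion a b j) (sheetCut a b c j)ᶜ :=
  ⟨mapsTo_zMap ha hb hab j, injOn_zMap ha hb hab j, surjOn_zMap ha hb hab j⟩

theorem uSheet_mem {a b c : ℝ} (ha : 1 < a) (hb : 0 < b) (hab : b < a) {j : Sheet} {z : ℂ}
    (hz : z ∈ (sheetCut a b c j)ᶜ) :
    uSheet a b c j z ∈ sheetRegion a b j ∧ zMap a b c (uSheet a b c j z) = z :=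
  Function.invFunOn_pos (surjOn_zMap ha hb hab j hz)

theorem uSheet_zMap {a b c : ℝ} (ha : 1 < a) (hb : 0 < b) (hab : b < a) {j : Sheet} {u : ℂ}
    (hu : u ∈ sheetRegion a b j) : uSheet a b c j (zMap a b c u) = u :=
  (injOn_zMap ha hb hab j).leftInvOn_invFunOn hu

theorem uSheet_hasDerivAt {a b c : ℝ} (ha : 1 < a) (hb : 0 < b) (hab : b < a) {j : Sheet} {z : ℂ}
    (hz : z ∈ (sheetCut a b c j)ᶜ) :
    HasDerivAt (uSheet a b c j) (zMapDeriv a b c (uSheet a b c j z))⁻¹ z := by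
  obtain ⟨hu, he⟩ := uSheet_mem ha hb hab hz
  have h := (zMap_hasStrictDerivAt a b c
    (ne_zero_of_mem_sheetRegion hb hab hu)).to_local_left_inverse
    (zMapDeriv_ne_zero ha hb hab hu) (g := uSheet a b c j) (by
      filter_upwards [(isOpen_sheetRegion hb hab j).mem_nhds hu] with v hv
      exact uSheet_zMap ha hb hab hv)
  rw [he] at h
  exact h.hasDerivAt

theorem mem_compl_sheetCut (a b c : ℝ) (j : Sheet) {z : ℂ} (hz : z.im ≠ 0) :
    z ∈ (sheetCut a b c j)ᶜ := by
  intro h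
  cases j <;> exact hz h.1

theorem uSheet_conj {a b c : ℝ} (ha : 1 < a) (hb : 0 < b) (hab : b < a) {j : Sheet} {z : ℂ}
    (hz : z.im ≠ 0) : uSheet a b c j (conj z) = conj (uSheet a b c j z) := by
  obtain ⟨hu, he⟩ := uSheet_mem ha hb hab (mem_compl_sheetCut a b c j hz)
  have := uSheet_zMap (c := c) ha hb hab ((conj_mem_sheetRegion hb hab).2 hu)
  rwa [zMap_conj, he] at this

theorem uSheet_neg {a b c : ℝ} (ha : 1 < a) (hb : 0 < b) (hab : b < a) {j : Sheet} {z : ℂ}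
    (hz : z.im ≠ 0) : uSheet a b c j.neg (-z) = -uSheet a b c j z := by
  obtain ⟨hu, he⟩ := uSheet_mem ha hb hab (mem_compl_sheetCut a b c j hz)
  have := uSheet_zMap (c := c) ha hb hab ((neg_mem_sheetRegion hb hab).2 hu)
  rwa [zMap_neg, he] at this

theorem Omega_re_conj (a b c : ℝ) (u : ℂ) :
    (Omega a b c (conj u)).re = (Omega a b c u).re := by
  -- On the negative axis the principal logarithm does not commute with conjugation, but the
  -- discrepancy is purely imaginary.
  have h : Omega a b c (conj u) - conj (Omega a b c u) =
      ((constA a b c * constA a c b * (den a b c / 3) : ℝ) : ℂ) *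
        (conj (Complex.log u) - Complex.log (conj u)) := by
    simp only [Omega, map_mul, map_add, map_sub, map_div₀, map_neg, map_pow, conj_ofReal, map_ofNat]
    push_cast
    ring_nf
  have h2 := congrArg Complex.re h
  rw [Complex.re_ofReal_mul, Complex.sub_re, Complex.sub_re, conj_re, conj_re, Complex.log_re,
    Complex.log_re, norm_conj, sub_self, mul_zero] at h2
  linarith

theorem phi_conj {a b c : ℝ} (ha : 1 < a) (hb : 0 < b) (hab : b < a) {j : Sheet} {z : ℂ}
    (hz : z.im ≠ 0) : phi a b c j (conj z) = phi a b c j z := by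
  rw [phi, uSheet_conj ha hb hab hz, Omega_re_conj, phi]

theorem phi_neg {a b c : ℝ} (ha : 1 < a) (hb : 0 < b) (hab : b < a) {j : Sheet} {z : ℂ}
    (hz : z.im ≠ 0) : phi a b c j.neg (-z) = phi a b c j z := by
  rw [phi, uSheet_neg ha hb hab hz, Omega_re_neg, phi]

/-! ### The sign of Q on the two curves. -/

/-- The equation S = 0 eliminates (Im u)², leaving a function of |u|² only. -/
theorem densityForm_of_curveForm_eq_zero {a b c : ℝ} (ha : 0 < a) (hb : 0 < b) {u : ℂ}
    (hS : curveForm a b u = 0) : densityForm a c u =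
      (1 - a ^ 2 * normSq u) * (1 - c ^ 2 * normSq u)
        - c ^ 2 / b ^ 2 * normSq u ^ 2 * (normSq u - a ^ 2) * (normSq u - b ^ 2) := by
  have h : 4 / 3 * u.im ^ 2 =
      (normSq u ^ 3 - (a ^ 2 + b ^ 2) * normSq u ^ 2 + a ^ 2 * b ^ 2 * normSq u)
        / (a ^ 2 * b ^ 2) := by
    rw [curveForm] at hS
    field_simp
    linarith
  have : densityForm a c u = 1 - (a ^ 2 + c ^ 2) * normSq u + a ^ 2 * c ^ 2 * normSq u ^ 2
    - a ^ 2 * c ^ 2 * normSq u * (4 / 3 * u.im ^ 2) := by rw [densityForm]; ring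
  rw [this, h]
  field_simp
  ring

theorem curveForm_eq_zero_cases {a b : ℝ} (hb : 0 < b) {u : ℂ} (hu : u ≠ 0)
    (hS : curveForm a b u = 0) : normSq u ≤ b ^ 2 ∨ a ^ 2 ≤ normSq u := by
  have hn : 0 < normSq u := by simpa using hu
  by_contra! h
  have h1 : normSq u * ((normSq u - a ^ 2) * (normSq u - b ^ 2))
      = 4 / 3 * a ^ 2 * b ^ 2 * u.im ^ 2 := by
    rw [curveForm] at hS
    linear_combination hS
  have h2 : normSq u * ((normSq u - a ^ 2) * (normSq u - b ^ 2)) < 0 :=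
    mul_neg_of_pos_of_neg hn (mul_neg_of_neg_of_pos (by linarith) (by linarith))
  have : 0 ≤ 4 / 3 * a ^ 2 * b ^ 2 * u.im ^ 2 := by positivity
  linarith

/-- Put p = a², q = b², s = c², t = |u|². The subtracted term factors as t(p - t) · t(s - st/q). Its
nonnegative factors are smaller than 1 - st and 1 - pt respectively, because pq < 1, s < q and t ≤
q. -/
theorem densityForm_pos {a b c : ℝ} (hb : 0 < b) (ha : 1 < a) (hab1 : a * b < 1)
    (hb1 : b < 1) (hc : 0 < c) (hcb : c < b) {u : ℂ} (hu : u ≠ 0) (hS : curveForm a b u = 0)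
    (ht : normSq u ≤ b ^ 2) : 0 < densityForm a c u := by
  have hn : 0 < normSq u := by simpa using hu
  rw [densityForm_of_curveForm_eq_zero (by linarith) hb hS]
  generalize normSq u = t at *
  have hab2 : a ^ 2 * b ^ 2 < 1 := by
    have : 0 < a * b := by positivity
    nlinarith
  have hc2 : c ^ 2 < b ^ 2 := by nlinarith
  have hb2 : b ^ 2 < 1 := by nlinarith
  have ha2 : 1 < a ^ 2 := by nlinarith
  have hc0 : 0 < c ^ 2 := by positivity
  have hb0 : 0 < b ^ 2 := by positivity
  generalize a ^ 2 = p at *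
  generalize b ^ 2 = q at *
  generalize c ^ 2 = s at *
  have hpt : p * t ≤ p * q := by gcongr
  have h1 : t * (p - t) < 1 - s * t := by nlinarith
  have h2 : t * (s - s * t / q) < 1 - p * t := by
    have e : 1 - p * t - t * (s - s * t / q)
        = (1 - p * q) + (q - t) * ((p - s) + s * ((q - t) / q)) := by
      field_simp
      ring
    have : 0 ≤ (q - t) / q := div_nonneg (by linarith) hb0.le
    have : 0 ≤ s * ((q - t) / q) := by positivity
    have : 0 ≤ (q - t) * ((p - s) + s * ((q - t) / q)) :=
      mul_nonneg (by linarith) (by linarith)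
    linarith
  have h3 : 0 ≤ t * (p - t) := mul_nonneg hn.le (by linarith)
  have h4 : 0 ≤ t * (s - s * t / q) := by
    have : s * t / q ≤ s := by rw [div_le_iff₀ hb0]; gcongr
    exact mul_nonneg hn.le (by linarith)
  have h5 := mul_lt_mul'' h1 h2 h3 h4
  have e : s / q * t ^ 2 * (t - p) * (t - q) = t * (p - t) * (t * (s - s * t / q)) := by
    field_simp
    ring
  rw [e]
  linarith

theorem densityForm_neg {a b c : ℝ} (hb : 0 < b) (ha : 1 < a) (hab1 : a * b < 1)
    (hb1 : b < 1) (hc : 0 < c) (hcb : c < b) {u : ℂ} (hS : curveForm a b u = 0)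
    (ht : a ^ 2 ≤ normSq u) : densityForm a c u < 0 := by
  rw [densityForm_of_curveForm_eq_zero (by linarith) hb hS]
  generalize normSq u = t at *
  have hab2 : a ^ 2 * b ^ 2 < 1 := by
    have : 0 < a * b := by positivity
    nlinarith
  have hc2 : c ^ 2 < b ^ 2 := by nlinarith
  have hb2 : b ^ 2 < 1 := by nlinarith
  have ha2 : 1 < a ^ 2 := by nlinarith
  have hc0 : 0 < c ^ 2 := by positivity
  have hb0 : 0 < b ^ 2 := by positivity
  generalize a ^ 2 = p at *
  generalize b ^ 2 = q at *
  generalize c ^ 2 = s at *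
  have ht1 : 1 < t := by linarith
  have hpt : 0 < p * t - 1 := by nlinarith
  have hR : 0 ≤ s / q * t ^ 2 * (t - p) * (t - q) := by
    have h1 : 0 ≤ t - p := by linarith
    have h2 : 0 ≤ t - q := by linarith
    positivity
  -- Here pt > 1. If st < 1, the product (1 - pt)(1 - st) is already negative. If st = 1, it
  -- vanishes, and t ≠ p since ps < pq < 1. If st > 1, both factors are negative, and their absolute
  -- values are compared with the factors t(t - q) and (s/q)t(t - p) of the subtracted term.
  rcases lt_trichotomy (s * t) 1 with h | h | h
  · have := mul_pos hpt (sub_pos.2 h)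
    linarith
  · have h1 : 0 < t - p := by
      by_contra! h'
      have : t = p := le_antisymm (by linarith) ht
      subst this
      nlinarith
    have h2 : 0 < t - q := by linarith
    have : 0 < s / q * t ^ 2 * (t - p) * (t - q) := by positivity
    rw [h]
    linarith
  · have hqt : 1 < q * t := by nlinarith
    have h6 : 0 < t ^ 2 + 1 - (p + q) * t := by
      have e : q * (t ^ 2 + 1 - (p + q) * t) = (q * t - 1) * (t - q) + (1 - p * q) * t := by ring
      have : 0 < (q * t - 1) * (t - q) := mul_pos (by linarith) (by linarith)
      have : 0 < (1 - p * q) * t := mul_pos (by linarith) (by linarith)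
      exact pos_of_mul_pos_right (by linarith : 0 < q * (t ^ 2 + 1 - (p + q) * t)) hb0.le
    have h7 : p * t - 1 < t * (t - q) := by linarith
    have h8 : s * t - 1 < s / q * t * (t - p) := by
      have e : s / q * t * (t - p) - (s * t - 1)
          = s / q * (t ^ 2 + 1 - (p + q) * t) + (1 - s / q) := by
        field_simp
        ring
      have : s / q < 1 := by rw [div_lt_one hb0]; exact hc2
      have : 0 < s / q * (t ^ 2 + 1 - (p + q) * t) := by positivity
      linarith
    have h9 := mul_lt_mul'' h7 h8 hpt.le (by linarith)
    have e : s / q * t ^ 2 * (t - p) * (t - q) = t * (t - q) * (s / q * t * (t - p)) := by ring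
    rw [e]
    linarith

/-! ### Solutions over the cuts. -/

/-- Over a real point at which two sheets have a solution, the remaining solutions are conjugate to
each other as soon as one of them is not real. -/
theorem eq_or_eq_conj {a b c : ℝ} (ha : 1 < a) (hb : 0 < b) (hab : b < a) {l m : Sheet}
    (hlm : l ≠ m) {z : ℂ} (hz : z.im = 0) (hl : z ∈ (sheetCut a b c l)ᶜ)
    (hm : z ∈ (sheetCut a b c m)ᶜ) {u v : ℂ} (hu0 : u ≠ 0) (hv0 : v ≠ 0)
    (hu : zMap a b c u = z) (hv : zMap a b c v = z)
    (hul : u ∉ sheetRegion a b l) (hum : u ∉ sheetRegion a b m)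
    (hvl : v ∉ sheetRegion a b l) (hvm : v ∉ sheetRegion a b m) (him : u.im ≠ 0) :
    v = u ∨ v = conj u := by
  classical
  by_contra! hne
  obtain ⟨r, hr, hrz⟩ := surjOn_zMap ha hb hab l hl
  obtain ⟨s, hs, hsz⟩ := surjOn_zMap ha hb hab m hm
  have hzc : conj z = z := conj_eq_iff_im.2 hz
  have huu : u ≠ conj u := fun h => him (conj_eq_iff_im.1 h.symm)
  have h1 : r ≠ s := fun h => hlm (sheet_eq_of_mem hb hab hr (h ▸ hs))
  have hcl : conj u ∉ sheetRegion a b l := fun h => hul ((conj_mem_sheetRegion hb hab).1 h)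
  have hcm : conj u ∉ sheetRegion a b m := fun h => hum ((conj_mem_sheetRegion hb hab).1 h)
  have e1 : r ≠ u := fun h => hul (h ▸ hr)
  have e2 : r ≠ v := fun h => hvl (h ▸ hr)
  have e3 : r ≠ conj u := fun h => hcl (h ▸ hr)
  have e4 : s ≠ u := fun h => hum (h ▸ hs)
  have e5 : s ≠ v := fun h => hvm (h ▸ hs)
  have e6 : s ≠ conj u := fun h => hcm (h ▸ hs)
  -- As z is real, conj u is a solution too; a further v would make five solutions of a quartic.
  have hcard : ({r, s, v, u, conj u} : Finset ℂ).card = 5 := by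
    rw [Finset.card_insert_of_notMem, Finset.card_insert_of_notMem, Finset.card_insert_of_notMem,
      Finset.card_insert_of_notMem, Finset.card_singleton] <;>
      simp only [Finset.mem_insert, Finset.mem_singleton, not_or] <;> tauto
  have hr0 := ne_zero_of_mem_sheetRegion hb hab hr
  have hs0 := ne_zero_of_mem_sheetRegion hb hab hs
  have := card_preimage_le (constA_pos (b := b) (c := c) ha) z {r, s, v, u, conj u} (by
    simp only [Finset.mem_insert, Finset.mem_singleton, forall_eq_or_imp, forall_eq]
    exact ⟨⟨hr0, hrz⟩, ⟨hs0, hsz⟩, ⟨hv0, hv⟩, ⟨hu0, hu⟩, by simpa using hu0,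
      by rw [zMap_conj, hu, hzc]⟩)
  omega

/-- Solutions over `[β, ∞)` outside sheets one and three. -/
theorem outer_cut_solutions {a b c : ℝ} (ha : 1 < a) (hb : 0 < b) (hab : b < a) {z : ℂ}
    (hz : z.im = 0) (hzb : beta a b c ≤ z.re) {u v : ℂ} (hu0 : u ≠ 0) (hv0 : v ≠ 0)
    (hu : zMap a b c u = z) (hv : zMap a b c v = z)
    (hul : u ∉ sheetRegion a b .one) (hum : u ∉ sheetRegion a b .three)
    (hvl : v ∉ sheetRegion a b .one) (hvm : v ∉ sheetRegion a b .three) :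
    curveForm a b u = 0 ∧ (v = u ∨ v = conj u) ∧ (u.im = 0 → z.re = beta a b c) := by
  have hal := alpha_pos (c := c) ha hb
  have halb := alpha_lt_beta (c := c) ha hb hab
  have hpos : 0 < z.re := by linarith
  have hcl : z ∈ (sheetCut a b c .one)ᶜ := fun h => by
    have := h.2
    rw [abs_of_pos hpos] at this
    linarith
  have hcm : z ∈ (sheetCut a b c .three)ᶜ := fun h => by
    have : z.re ≤ -beta a b c := h.2
    linarith
  -- A real solution in neither region has |w| ≤ a if positive and w ≤ -b if negative. Negative ones
  -- give X ≤ -α, and positive ones other than b give X < β.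
  have key : ∀ w : ℂ, w ≠ 0 → zMap a b c w = z → w ∉ sheetRegion a b .one →
      w ∉ sheetRegion a b .three → w.im = 0 → w = b := by
    intro w hw0 hw h1 h3 him
    obtain ⟨x, rfl⟩ : ∃ x : ℝ, w = x := ⟨w.re, Complex.ext rfl (by simpa using him)⟩
    rw [mem_one_ofReal hb hab, not_lt, abs_le] at h1
    rw [mem_three_ofReal hb hab] at h3
    have hx0 : x ≠ 0 := by exact_mod_cast hw0
    rcases lt_or_gt_of_ne hx0 with hx | hx
    · exfalso
      have hx2 : b ≤ -x := by
        by_contra! h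
        exact h3 ⟨by linarith, hx⟩
      have : alpha a b c ≤ (zMap a b c (-x : ℝ)).re := by
        rcases eq_or_ne (-x) a with h | h
        · rw [h, alpha]
        · exact (alpha_lt_zMap ha hb hab hx2 h).le
      rw [re_zMap_neg, hw] at this
      linarith
    · by_contra hne
      have := zMap_lt_beta (c := c) ha hb hab hx h1.2 (by exact_mod_cast hne)
      rw [hw] at this
      linarith
  by_cases hui : u.im = 0
  · have hub := key u hu0 hu hul hum hui
    have hzb : z.re = beta a b c := by rw [← hu, hub, beta]
    refine ⟨by rw [hub, curveForm_ofReal]; ring, ?_, fun _ => hzb⟩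
    by_cases hvi : v.im = 0
    · exact Or.inl ((key v hv0 hv hvl hvm hvi).trans hub.symm)
    · rcases eq_or_eq_conj ha hb hab (by simp) hz hcl hcm hv0 hu0 hv hu hvl hvm hul hum hvi with h | h
      · exact Or.inl h.symm
      · exact Or.inr (by rw [h, conj_conj])
  · refine ⟨?_, eq_or_eq_conj ha hb hab (by simp) hz hcl hcm hu0 hv0 hu hv hul hum hvl hvm hui,
      fun h => absurd h hui⟩
    have hn : normSq u ≠ 0 := by simpa using hu0
    rw [← hu, zMap_im _ _ _ hu0] at hz
    simpa [hui, hn, (constA_pos ha).ne'] using hz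

/-- Solutions over `[-α, α]` outside sheets three and four. -/
theorem inner_cut_solutions {a b c : ℝ} (ha : 1 < a) (hb : 0 < b) (hab : b < a) {z : ℂ}
    (hz : z.im = 0) (hza : |z.re| ≤ alpha a b c) {u v : ℂ} (hu0 : u ≠ 0) (hv0 : v ≠ 0)
    (hu : zMap a b c u = z) (hv : zMap a b c v = z)
    (hul : u ∉ sheetRegion a b .three) (hum : u ∉ sheetRegion a b .four)
    (hvl : v ∉ sheetRegion a b .three) (hvm : v ∉ sheetRegion a b .four) :
    curveForm a b u = 0 ∧ (v = u ∨ v = conj u) ∧ (u.im = 0 → |z.re| = alpha a b c) := by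
  have hal := alpha_pos (c := c) ha hb
  have halb := alpha_lt_beta (c := c) ha hb hab
  have hza' := abs_le.1 hza
  have hcl : z ∈ (sheetCut a b c .three)ᶜ := fun h => by
    have : z.re ≤ -beta a b c := h.2
    linarith
  have hcm : z ∈ (sheetCut a b c .four)ᶜ := fun h => by
    have : beta a b c ≤ z.re := h.2
    linarith
  have hneg : (zMap a b c (-a : ℝ)).re = -alpha a b c := by rw [re_zMap_neg, alpha]
  have key : ∀ w : ℂ, w ≠ 0 → zMap a b c w = z → w ∉ sheetRegion a b .three →
      w ∉ sheetRegion a b .four → w.im = 0 →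
      (w = a ∧ z.re = alpha a b c) ∨ (w = (-a : ℝ) ∧ z.re = -alpha a b c) := by
    intro w hw0 hw h3 h4 him
    obtain ⟨x, rfl⟩ : ∃ x : ℝ, w = x := ⟨w.re, Complex.ext rfl (by simpa using him)⟩
    rw [mem_four_ofReal hb hab] at h4
    rw [mem_three_ofReal hb hab] at h3
    have hx0 : x ≠ 0 := by exact_mod_cast hw0
    rcases lt_or_gt_of_ne hx0 with hx | hx
    · have hx2 : b ≤ -x := by
        by_contra! h
        exact h3 ⟨by linarith, hx⟩
      have hxa : -x = a := by
        by_contra hne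
        have := alpha_lt_zMap (c := c) ha hb hab hx2 hne
        rw [re_zMap_neg, hw] at this
        linarith [hza'.1]
      have : x = -a := by linarith
      subst this
      exact Or.inr ⟨rfl, by rw [← hw, hneg]⟩
    · have hx2 : b ≤ x := by
        by_contra! h
        exact h4 ⟨hx, h⟩
      have hxa : x = a := by
        by_contra hne
        have := alpha_lt_zMap (c := c) ha hb hab hx2 hne
        rw [hw] at this
        linarith [hza'.2]
      subst hxa
      exact Or.inl ⟨rfl, by rw [← hw, alpha]⟩
  by_cases hui : u.im = 0
  · have hub := key u hu0 hu hul hum hui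
    refine ⟨?_, ?_, fun _ => ?_⟩
    · rcases hub with ⟨h, -⟩ | ⟨h, -⟩ <;> rw [h, curveForm_ofReal] <;> ring
    · by_cases hvi : v.im = 0
      · left
        rcases hub with ⟨h, h'⟩ | ⟨h, h'⟩ <;>
        rcases key v hv0 hv hvl hvm hvi with ⟨k, k'⟩ | ⟨k, k'⟩
        · rw [h, k]
        · linarith
        · linarith
        · rw [h, k]
      · rcases eq_or_eq_conj ha hb hab (by simp) hz hcl hcm hv0 hu0 hv hu hvl hvm hul hum hvi with h | h
        · exact Or.inl h.symm
        · exact Or.inr (by rw [h, conj_conj])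
    · rcases hub with ⟨-, h⟩ | ⟨-, h⟩ <;> rw [h]
      · exact abs_of_pos hal
      · rw [abs_neg, abs_of_pos hal]
  · refine ⟨?_, eq_or_eq_conj ha hb hab (by simp) hz hcl hcm hu0 hv0 hu hv hul hum hvl hvm hui,
      fun h => absurd h hui⟩
    have hn : normSq u ≠ 0 := by simpa using hu0
    rw [← hu, zMap_im _ _ _ hu0] at hz
    simpa [hui, hn, (constA_pos ha).ne'] using hz

/-! ### Signs of Im u_j, and lenses on which Q has a constant sign. -/

theorem notMem_of_tendsto {a b : ℝ} (hb : 0 < b) (hab : b < a) {j k : Sheet} (hjk : j ≠ k)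
    {u : ℕ → ℂ} {u' : ℂ} (hu : ∀ n, u n ∈ sheetRegion a b j) (h : Tendsto u atTop (𝓝 u')) :
    u' ∉ sheetRegion a b k := by
  intro hk
  obtain ⟨n, hn⟩ := (h.eventually ((isOpen_sheetRegion hb hab k).mem_nhds hk)).exists
  exact hjk (sheet_eq_of_mem hb hab (hu n) hn)

/-- Solutions on two sheets over a convergent sequence have a common convergent subsequence. -/
theorem exists_subseq_pair {a b c : ℝ} (ha : 1 < a) (hb : 0 < b) {u v z : ℕ → ℂ} {z' : ℂ}
    (hz : Tendsto z atTop (𝓝 z')) (hu0 : ∀ n, u n ≠ 0) (hv0 : ∀ n, v n ≠ 0)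
    (hu : ∀ n, zMap a b c (u n) = z n) (hv : ∀ n, zMap a b c (v n) = z n) :
    ∃ (u' v' : ℂ) (φ : ℕ → ℕ), StrictMono φ ∧ Tendsto (u ∘ φ) atTop (𝓝 u') ∧
      Tendsto (v ∘ φ) atTop (𝓝 v') ∧ u' ≠ 0 ∧ v' ≠ 0 ∧ zMap a b c u' = z' ∧ zMap a b c v' = z' := by
  have hA := constA_pos (b := b) (c := c) ha
  obtain ⟨u', φ, hφ, hu'⟩ := exists_subseq_tendsto hA hz hu0 hu
  obtain ⟨v', χ, hχ, hv'⟩ := exists_subseq_tendsto (u := v ∘ φ) (z := z ∘ φ) hA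
    (hz.comp hφ.tendsto_atTop) (fun n => hv0 _) (fun n => hv _)
  have h1 := hu'.comp hχ.tendsto_atTop
  have hφχ := hφ.comp hχ
  obtain ⟨a1, a2⟩ := zMap_eq_of_tendsto (u := (u ∘ φ) ∘ χ) hA (by linarith) hb h1
    (hz.comp hφχ.tendsto_atTop) (fun n => hu0 _) (fun n => hu _)
  obtain ⟨b1, b2⟩ := zMap_eq_of_tendsto (u := (v ∘ φ) ∘ χ) hA (by linarith) hb hv'
    (hz.comp hφχ.tendsto_atTop) (fun n => hv0 _) (fun n => hv _)
  exact ⟨u', v', φ ∘ χ, hφχ, h1, hv', a1, b1, a2, b2⟩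

theorem uSheet_im_pos {a b c : ℝ} (ha : 1 < a) (hb : 0 < b) (hab : b < a) {j : Sheet} (hj : j ≠ .two)
    {z : ℂ} (hz : 0 < z.im) : 0 < (uSheet a b c j z).im := by
  obtain ⟨hu, he⟩ := uSheet_mem ha hb hab (mem_compl_sheetCut a b c j hz.ne')
  have hu0 := ne_zero_of_mem_sheetRegion hb hab hu
  have hA := constA_pos (b := b) (c := c) ha
  have hS : 0 < curveForm a b (uSheet a b c j z) := by
    cases j
    · exact ((mem_sheetRegion_one hb hab _).1 hu).1
    · exact absurd rfl hj
    · exact ((mem_sheetRegion_three hb hab _).1 hu).1.1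
    · exact ((mem_sheetRegion_four hb hab _).1 hu).1.1
  have hn : 0 < normSq (uSheet a b c j z) := by simpa using hu0
  rw [← he, zMap_im _ _ _ hu0] at hz
  by_contra! h
  have : (uSheet a b c j z).im * curveForm a b (uSheet a b c j z) ≤ 0 :=
    mul_nonpos_of_nonpos_of_nonneg h hS.le
  exact absurd hz (not_lt.2 (mul_nonpos_of_nonneg_of_nonpos hA.le
    (div_nonpos_of_nonpos_of_nonneg this (by positivity))))

theorem uSheet_two_im_neg {a b c : ℝ} (ha : 1 < a) (hb : 0 < b) (hab : b < a)
    {z : ℂ} (hz : 0 < z.im) : (uSheet a b c .two z).im < 0 := by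
  obtain ⟨hu, he⟩ := uSheet_mem ha hb hab (mem_compl_sheetCut a b c .two hz.ne')
  have hu0 := ne_zero_of_mem_sheetRegion hb hab hu
  have hA := constA_pos (b := b) (c := c) ha
  have hS := (mem_sheetRegion_two hb hab _).1 hu
  have hn : 0 < normSq (uSheet a b c .two z) := by simpa using hu0
  rw [← he, zMap_im _ _ _ hu0] at hz
  by_contra! h
  have : (uSheet a b c .two z).im * curveForm a b (uSheet a b c .two z) ≤ 0 :=
    mul_nonpos_of_nonneg_of_nonpos h hS.le
  exact absurd hz (not_lt.2 (mul_nonpos_of_nonneg_of_nonpos hA.le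
    (div_nonpos_of_nonpos_of_nonneg this (by positivity))))

/-- The cut [β, ∞) is unbounded, so compactness there must come from boundedness of the region in
the u-plane instead of from a bound on z. -/
theorem normSq_lt_of_mem_two {a b : ℝ} (ha : 1 < a) (hb : 0 < b) (hab : b < a) {u : ℂ}
    (hu : u ∈ sheetRegion a b .two) : normSq u < a ^ 2 + b ^ 2 + a ^ 2 * b ^ 2 := by
  have hn : 0 < normSq u := by simpa using ne_zero_of_mem_sheetRegion hb hab hu
  have hS := (mem_sheetRegion_two hb hab _).1 hu
  by_contra! h
  have hy : u.im ^ 2 ≤ normSq u := by rw [normSq_apply]; nlinarith [sq_nonneg u.re]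
  have hP : 0 < a ^ 2 * b ^ 2 := by positivity
  have h1 : a ^ 2 * b ^ 2 * u.im ^ 2 ≤ a ^ 2 * b ^ 2 * normSq u := by gcongr
  have h2 : curveForm a b u = normSq u * (normSq u * (normSq u - (a ^ 2 + b ^ 2)) - a ^ 2 * b ^ 2 / 3)
    + 4 / 3 * (a ^ 2 * b ^ 2 * normSq u - a ^ 2 * b ^ 2 * u.im ^ 2) := by rw [curveForm]; ring
  have h3 : 1 < a ^ 2 := by nlinarith
  have h5 : 1 * (a ^ 2 * b ^ 2) ≤ normSq u * (normSq u - (a ^ 2 + b ^ 2)) := by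
    apply mul_le_mul <;> nlinarith [sq_nonneg b]
  have h6 : 0 ≤ normSq u * (normSq u * (normSq u - (a ^ 2 + b ^ 2)) - a ^ 2 * b ^ 2 / 3) :=
    mul_nonneg hn.le (by linarith)
  linarith

theorem norm_le_of_normSq_lt {r : ℝ} {u : ℂ} (h : normSq u < r) : ‖u‖ ≤ √r :=
  Real.le_sqrt_of_sq_le (by rw [← normSq_eq_norm_sq]; exact h.le)

theorem densityForm_zero (a c : ℝ) : densityForm a c 0 = 1 := by simp [densityForm]

/-- By contradiction with slopes 1/(n + 1): the solutions accumulate either on the inner curve or,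
when z escapes to infinity, at u = 0, and Q is positive in both places. -/
theorem exists_lensRight_densityForm_pos {a b c : ℝ} (h : GenericParams a b c) :
    ∃ δ : ℝ, 0 < δ ∧ ∀ z ∈ lensRight (beta a b c) δ, 0 < z.im →
      0 < densityForm a c (uSheet a b c .four z) ∧ 0 < densityForm a c (uSheet a b c .two z) := by
  obtain ⟨hb, hb1, ha, hab1, hc, hcb⟩ := h
  have hab : b < a := hb1.trans ha
  have hab1 : a * b < 1 := by rwa [lt_inv_comm₀ (by linarith) hb, lt_inv_comm₀ hb (by linarith),
    ← one_div, lt_div_iff₀ hb] at hab1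
  by_contra! hcon
  choose z hz him hneg using fun n : ℕ => hcon (1 / ((n : ℝ) + 1)) (by positivity)
  have hu := fun n => uSheet_mem ha hb hab (mem_compl_sheetCut a b c .four (him n).ne')
  have hv := fun n => uSheet_mem ha hb hab (mem_compl_sheetCut a b c .two (him n).ne')
  set u := fun n => uSheet a b c .four (z n)
  set v := fun n => uSheet a b c .two (z n)
  have hu0 : ∀ n, u n ≠ 0 := fun n => ne_zero_of_mem_sheetRegion hb hab (hu n).1
  have hv0 : ∀ n, v n ≠ 0 := fun n => ne_zero_of_mem_sheetRegion hb hab (hv n).1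
  have hut : ∀ n, 2 * normSq (u n) < a ^ 2 + b ^ 2 :=
    fun n => ((mem_sheetRegion_four hb hab _).1 (hu n).1).1.2
  have hQ := continuous_densityForm a c
  have hlim : ∀ (φ : ℕ → ℕ) (u' v' : ℂ), Tendsto (u ∘ φ) atTop (𝓝 u') →
      Tendsto (v ∘ φ) atTop (𝓝 v') → 0 < densityForm a c u' → 0 < densityForm a c v' → False := by
    intro φ u' v' h1 h2 h3 h4
    have e1 := ((hQ.tendsto _).comp h1).eventually (lt_mem_nhds h3)
    have e2 := ((hQ.tendsto _).comp h2).eventually (lt_mem_nhds h4)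
    obtain ⟨n, hn1, hn2⟩ := (e1.and e2).exists
    exact absurd hn2 (not_lt.2 (hneg (φ n) hn1))
  obtain ⟨u', -, φ, hφ, hu'⟩ := tendsto_subseq_of_bounded (s := Set.range u) (by
    rw [isBounded_iff_forall_norm_le]
    refine ⟨√(a ^ 2 + b ^ 2), ?_⟩
    rintro _ ⟨n, rfl⟩
    exact norm_le_of_normSq_lt (by have := normSq_nonneg (u n); linarith [hut n]))
    (fun n => Set.mem_range_self n)
  obtain ⟨v', -, χ, hχ, hv'⟩ := tendsto_subseq_of_bounded (s := Set.range (v ∘ φ)) (by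
    rw [isBounded_iff_forall_norm_le]
    refine ⟨√(a ^ 2 + b ^ 2 + a ^ 2 * b ^ 2), ?_⟩
    rintro _ ⟨n, rfl⟩
    exact norm_le_of_normSq_lt (normSq_lt_of_mem_two ha hb hab (hv _).1))
    (fun n => Set.mem_range_self n)
  have hu'' : Tendsto (u ∘ (φ ∘ χ)) atTop (𝓝 u') := hu'.comp hχ.tendsto_atTop
  have hmono : StrictMono (φ ∘ χ) := hφ.comp hχ
  -- This is the case z → ∞, settled by Q(0) = 1.
  by_cases hzero : u' = 0 ∧ v' = 0
  · refine hlim _ u' v' hu'' hv' ?_ ?_ <;> simp [hzero, densityForm_zero]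
  -- otherwise the points converge to a point of the cut
  obtain ⟨z', hz'⟩ : ∃ z', Tendsto (z ∘ (φ ∘ χ)) atTop (𝓝 z') := by
    rcases not_and_or.1 hzero with h0 | h0
    · refine ⟨_, ((zMap_continuousAt a b c h0).tendsto.comp hu'').congr fun n => ?_⟩
      exact (hu _).2
    · refine ⟨_, ((zMap_continuousAt a b c h0).tendsto.comp hv').congr fun n => ?_⟩
      exact (hv _).2
  have hre : Tendsto (fun n => (z ((φ ∘ χ) n)).re) atTop (𝓝 z'.re) :=
    (continuous_re.tendsto _).comp hz'
  have himt : Tendsto (fun n => (z ((φ ∘ χ) n)).im) atTop (𝓝 z'.im) :=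
    (continuous_im.tendsto _).comp hz'
  have hzim : z'.im = 0 := by
    refine tendsto_nhds_unique himt ?_
    have h1 := ((tendsto_one_div_add_atTop_nhds_zero_nat (𝕜 := ℝ)).comp
      hmono.tendsto_atTop).mul (hre.sub_const (beta a b c))
    rw [zero_mul] at h1
    refine squeeze_zero (fun n => (him _).le) (fun n => ?_) h1
    exact (le_abs_self _).trans (hz _).2.le
  have hzre : beta a b c ≤ z'.re := ge_of_tendsto' hre fun n => (hz _).1.le
  obtain ⟨u₁, v₁, ψ, hψ, hu1, hv1, a1, a2, a3, a4⟩ := exists_subseq_pair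
    (u := u ∘ (φ ∘ χ)) (v := v ∘ (φ ∘ χ)) ha hb hz'
    (fun n => hu0 _) (fun n => hv0 _) (fun n => (hu _).2) (fun n => (hv _).2)
  have m1 : ∀ k, Sheet.four ≠ k → u₁ ∉ sheetRegion a b k := fun k hk =>
    notMem_of_tendsto hb hab hk (fun n => (hu _).1) hu1
  have m2 : ∀ k, Sheet.two ≠ k → v₁ ∉ sheetRegion a b k := fun k hk =>
    notMem_of_tendsto hb hab hk (fun n => (hv _).1) hv1
  obtain ⟨hS, hpair, -⟩ := outer_cut_solutions ha hb hab hzim hzre a1 a2 a3 a4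
    (m1 _ (by simp)) (m1 _ (by simp)) (m2 _ (by simp)) (m2 _ (by simp))
  have ht : normSq u₁ ≤ b ^ 2 := by
    refine (curveForm_eq_zero_cases hb a1 hS).resolve_right fun h => ?_
    have h1 : 2 * normSq u₁ ≤ a ^ 2 + b ^ 2 :=
      le_of_tendsto' (((continuous_normSq.tendsto _).comp hu1).const_mul 2) fun n => (hut _).le
    nlinarith
  have hd := densityForm_pos hb ha hab1 hb1 hc hcb a1 hS ht
  refine hlim _ u₁ v₁ hu1 hv1 hd ?_
  rcases hpair with h | h <;> simpa [h, densityForm_conj] using hd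

/-- The same argument with the outer curve; the cut is compact, so no point at infinity arises. -/
theorem exists_lensBetween_densityForm_neg {a b c : ℝ} (h : GenericParams a b c) :
    ∃ δ : ℝ, 0 < δ ∧ ∀ z ∈ lensBetween (-alpha a b c) (alpha a b c) δ, 0 < z.im →
      densityForm a c (uSheet a b c .one z) < 0 ∧ densityForm a c (uSheet a b c .two z) < 0 := by
  obtain ⟨hb, hb1, ha, hab1, hc, hcb⟩ := h
  have hab : b < a := hb1.trans ha
  have hab1 : a * b < 1 := by rwa [lt_inv_comm₀ (by linarith) hb, lt_inv_comm₀ hb (by linarith),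
    ← one_div, lt_div_iff₀ hb] at hab1
  by_contra! hcon
  choose z hz him hneg using fun n : ℕ => hcon (1 / ((n : ℝ) + 1)) (by positivity)
  have hu := fun n => uSheet_mem ha hb hab (mem_compl_sheetCut a b c .one (him n).ne')
  have hv := fun n => uSheet_mem ha hb hab (mem_compl_sheetCut a b c .two (him n).ne')
  set u := fun n => uSheet a b c .one (z n)
  set v := fun n => uSheet a b c .two (z n)
  have hu0 : ∀ n, u n ≠ 0 := fun n => ne_zero_of_mem_sheetRegion hb hab (hu n).1
  have hv0 : ∀ n, v n ≠ 0 := fun n => ne_zero_of_mem_sheetRegion hb hab (hv n).1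
  have hut : ∀ n, a ^ 2 + b ^ 2 < 2 * normSq (u n) :=
    fun n => ((mem_sheetRegion_one hb hab _).1 (hu n).1).2
  have hQ := continuous_densityForm a c
  have hza : ∀ n, |(z n).re| ≤ alpha a b c := fun n =>
    abs_le.2 ⟨(hz n).1.1.le, (hz n).2.1.le⟩
  have hlens : ∀ n, (z n).im ≤ 1 / ((n : ℝ) + 1) * (alpha a b c - (z n).re) := fun n =>
    (le_abs_self _).trans (hz n).2.2.le
  obtain ⟨z', -, φ, hφ, hz'⟩ := tendsto_subseq_of_bounded (s := Set.range z) (by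
    rw [isBounded_iff_forall_norm_le]
    refine ⟨alpha a b c + 2 * alpha a b c, ?_⟩
    rintro _ ⟨n, rfl⟩
    have h1 := hza n
    have h2 := hlens n
    have h3 : 1 / ((n : ℝ) + 1) ≤ 1 := by
      rw [div_le_one (by positivity)]; linarith [n.cast_nonneg (α := ℝ)]
    have h4 := abs_le.1 h1
    have h5 : 1 / ((n : ℝ) + 1) * (alpha a b c - (z n).re) ≤ 1 * (alpha a b c - (z n).re) := by
      gcongr; linarith
    have h6 := Complex.norm_le_abs_re_add_abs_im (z n)
    rw [abs_of_pos (him n)] at h6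
    linarith) (fun n => Set.mem_range_self n)
  have hre : Tendsto (fun n => (z (φ n)).re) atTop (𝓝 z'.re) :=
    (continuous_re.tendsto _).comp hz'
  have himt : Tendsto (fun n => (z (φ n)).im) atTop (𝓝 z'.im) :=
    (continuous_im.tendsto _).comp hz'
  have hzim : z'.im = 0 := by
    refine tendsto_nhds_unique himt ?_
    have h1 := ((tendsto_one_div_add_atTop_nhds_zero_nat (𝕜 := ℝ)).comp
      hφ.tendsto_atTop).mul (hre.const_sub (alpha a b c))
    rw [zero_mul] at h1
    exact squeeze_zero (fun n => (him _).le) (fun n => hlens _) h1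
  have hzre : |z'.re| ≤ alpha a b c := le_of_tendsto' hre.abs fun n => hza _
  obtain ⟨u₁, v₁, ψ, hψ, hu1, hv1, a1, a2, a3, a4⟩ := exists_subseq_pair
    (u := u ∘ φ) (v := v ∘ φ) ha hb hz'
    (fun n => hu0 _) (fun n => hv0 _) (fun n => (hu _).2) (fun n => (hv _).2)
  have m1 : ∀ k, Sheet.one ≠ k → u₁ ∉ sheetRegion a b k := fun k hk =>
    notMem_of_tendsto hb hab hk (fun n => (hu _).1) hu1
  have m2 : ∀ k, Sheet.two ≠ k → v₁ ∉ sheetRegion a b k := fun k hk =>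
    notMem_of_tendsto hb hab hk (fun n => (hv _).1) hv1
  obtain ⟨hS, hpair, -⟩ := inner_cut_solutions ha hb hab hzim hzre a1 a2 a3 a4
    (m1 _ (by simp)) (m1 _ (by simp)) (m2 _ (by simp)) (m2 _ (by simp))
  have ht : a ^ 2 ≤ normSq u₁ := by
    refine (curveForm_eq_zero_cases hb a1 hS).resolve_left fun h => ?_
    have h1 : a ^ 2 + b ^ 2 ≤ 2 * normSq u₁ :=
      ge_of_tendsto' (((continuous_normSq.tendsto _).comp hu1).const_mul 2) fun n => (hut _).le
    nlinarith
  have hd := densityForm_neg hb ha hab1 hb1 hc hcb hS ht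
  have hd' : densityForm a c v₁ < 0 := by
    rcases hpair with h | h <;> simpa [h, densityForm_conj] using hd
  have e1 := ((hQ.tendsto _).comp hu1).eventually (gt_mem_nhds hd)
  have e2 := ((hQ.tendsto _).comp hv1).eventually (gt_mem_nhds hd')
  obtain ⟨n, hn1, hn2⟩ := (e1.and e2).exists
  exact absurd hn2 (not_lt.2 (hneg _ hn1))

/-! ### Growth of φ_j - φ_k away from the cuts. -/

/-- The factor X' cancels in the chain rule, leaving dΩ_j/dz = Y(u_j); the vertical derivative of
the real part is then Re(iY) = -Im Y. -/
theorem phi_vertical_hasDerivAt {a b c : ℝ} (ha : 1 < a) (hb : 0 < b) (hab : b < a) (j : Sheet)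
    (x : ℝ) {y : ℝ} (hy : 0 < y) :
    HasDerivAt (fun y : ℝ => phi a b c j ⟨x, y⟩)
      (constA a c b * ((uSheet a b c j ⟨x, y⟩).im / normSq (uSheet a b c j ⟨x, y⟩))
        * densityForm a c (uSheet a b c j ⟨x, y⟩)) y := by
  have hz := mem_compl_sheetCut a b c j (z := ⟨x, y⟩) hy.ne'
  obtain ⟨hu, he⟩ := uSheet_mem ha hb hab hz
  have hu0 := ne_zero_of_mem_sheetRegion hb hab hu
  have him : (uSheet a b c j ⟨x, y⟩).im ≠ 0 := by
    intro h
    have h1 : (zMap a b c (uSheet a b c j ⟨x, y⟩)).im = y := by rw [he]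
    rw [zMap_im _ _ _ hu0, h] at h1
    simp at h1
    exact hy.ne h1
  have h1 := (Omega_hasDerivAt a b c (mem_slitPlane_iff.2 (Or.inr him))).comp _
    (uSheet_hasDerivAt ha hb hab hz)
  rw [mul_assoc, mul_inv_cancel₀ (zMapDeriv_ne_zero ha hb hab hu), mul_one] at h1
  have h2 : HasDerivAt (fun y : ℝ => (⟨x, y⟩ : ℂ)) I y := by
    have h3 := ((ofRealCLM.hasDerivAt (x := y)).mul_const I).const_add (x : ℂ)
    simp only [ofRealCLM_apply, ofReal_one, one_mul] at h3
    refine h3.congr_of_eventuallyEq (Eventually.of_forall fun t => ?_)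
    exact mk_eq_add_mul_I x t
  have h4 := reCLM.hasFDerivAt.comp_hasDerivAt y (h1.comp y h2)
  refine h4.congr_deriv ?_
  rw [reCLM_apply, mul_I_re, yMap_im _ _ _ hu0, neg_neg]

/-- Here l and m are the two sheets on which x is not on a cut. The limits from sheets j and k are
then equal or conjugate, and Re Ω does not distinguish them. Nonreal limits keep clear of the
logarithm's branch cut. Convergence along one sequence suffices, since monotonicity does the rest.
-/
theorem exists_phi_sub_tendsto_zero {a b c : ℝ} (ha : 1 < a) (hb : 0 < b) (hab : b < a)
    {j k l m : Sheet} (hjl : j ≠ l) (hjm : j ≠ m) (hkl : k ≠ l) (hkm : k ≠ m) (x : ℝ)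
    (hpair : ∀ u v : ℂ, u ≠ 0 → v ≠ 0 → zMap a b c u = x → zMap a b c v = x →
      u ∉ sheetRegion a b l → u ∉ sheetRegion a b m →
      v ∉ sheetRegion a b l → v ∉ sheetRegion a b m → u.im ≠ 0 ∧ (v = u ∨ v = conj u)) :
    ∃ y : ℕ → ℝ, (∀ n, 0 < y n) ∧ Tendsto y atTop (𝓝 0) ∧
      Tendsto (fun n => phi a b c j ⟨x, y n⟩ - phi a b c k ⟨x, y n⟩) atTop (𝓝 0) := by
  let y : ℕ → ℝ := fun n => 1 / ((n : ℝ) + 1)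
  have hy : ∀ n, 0 < y n := fun n => by simp only [y]; positivity
  have hyt : Tendsto y atTop (𝓝 0) := tendsto_one_div_add_atTop_nhds_zero_nat
  let z : ℕ → ℂ := fun n => ⟨x, y n⟩
  have hzt : Tendsto z atTop (𝓝 (x : ℂ)) := by
    have h1 : Tendsto (fun n => (x : ℂ) + (y n : ℂ) * I) atTop (𝓝 ((x : ℂ) + ((0 : ℝ) : ℂ) * I)) :=
      (((continuous_ofReal.tendsto _).comp hyt).mul_const I).const_add _
    simp only [ofReal_zero, zero_mul, add_zero] at h1
    exact h1.congr fun n => (mk_eq_add_mul_I _ _).symm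
  have hu := fun n => uSheet_mem ha hb hab (mem_compl_sheetCut a b c j (z := z n) (hy n).ne')
  have hv := fun n => uSheet_mem ha hb hab (mem_compl_sheetCut a b c k (z := z n) (hy n).ne')
  obtain ⟨u', v', φ, hφ, hu', hv', a1, a2, a3, a4⟩ := exists_subseq_pair
    (u := fun n => uSheet a b c j (z n)) (v := fun n => uSheet a b c k (z n)) ha hb hzt
    (fun n => ne_zero_of_mem_sheetRegion hb hab (hu n).1)
    (fun n => ne_zero_of_mem_sheetRegion hb hab (hv n).1) (fun n => (hu n).2) (fun n => (hv n).2)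
  obtain ⟨him, h⟩ := hpair u' v' a1 a2 a3 a4
    (notMem_of_tendsto hb hab hjl (fun n => (hu _).1) hu')
    (notMem_of_tendsto hb hab hjm (fun n => (hu _).1) hu')
    (notMem_of_tendsto hb hab hkl (fun n => (hv _).1) hv')
    (notMem_of_tendsto hb hab hkm (fun n => (hv _).1) hv')
  have him' : v'.im ≠ 0 := by
    rcases h with h | h <;> simpa [h] using him
  have hΩ : (Omega a b c u').re - (Omega a b c v').re = 0 := by
    rcases h with h | h <;> simp [h, Omega_re_conj]
  have hc : ∀ w : ℂ, w.im ≠ 0 → ContinuousAt (fun w => (Omega a b c w).re) w := fun w hw =>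
    continuous_re.continuousAt.comp
      (Omega_hasDerivAt a b c (mem_slitPlane_iff.2 (Or.inr hw))).continuousAt
  refine ⟨y ∘ φ, fun n => hy _, hyt.comp hφ.tendsto_atTop, ?_⟩
  rw [← hΩ]
  exact ((hc u' him).tendsto.comp hu').sub ((hc v' him').tendsto.comp hv')

/-- If `Re (Ω_j - Ω_k)` vanishes on the cut in the limit and increases along a vertical segment
issuing from it, it is positive there. -/
theorem phi_sub_pos_of_vertical {a b c : ℝ} (ha : 1 < a) (hb : 0 < b) (hab : b < a)
    {j k : Sheet} {x y₀ : ℝ} (hy₀ : 0 < y₀)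
    (hlim : ∃ y : ℕ → ℝ, (∀ n, 0 < y n) ∧ Tendsto y atTop (𝓝 0) ∧
      Tendsto (fun n => phi a b c j ⟨x, y n⟩ - phi a b c k ⟨x, y n⟩) atTop (𝓝 0))
    (hj : ∀ y, 0 < y → y ≤ y₀ →
      0 < (uSheet a b c j ⟨x, y⟩).im * densityForm a c (uSheet a b c j ⟨x, y⟩))
    (hk : ∀ y, 0 < y → y ≤ y₀ →
      (uSheet a b c k ⟨x, y⟩).im * densityForm a c (uSheet a b c k ⟨x, y⟩) < 0) :
    0 < phi a b c j ⟨x, y₀⟩ - phi a b c k ⟨x, y₀⟩ := by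
  have hB := constA_pos (b := c) (c := b) ha
  have hd := fun y (hy : 0 < y) => (phi_vertical_hasDerivAt (c := c) ha hb hab j x hy).sub
    (phi_vertical_hasDerivAt (c := c) ha hb hab k x hy)
  have hns : ∀ (i : Sheet) (y : ℝ), 0 < y → 0 < normSq (uSheet a b c i ⟨x, y⟩) := by
    intro i y hy
    simpa using ne_zero_of_mem_sheetRegion hb hab
      (uSheet_mem ha hb hab (mem_compl_sheetCut a b c i (z := ⟨x, y⟩) hy.ne')).1
  have hmono : StrictMonoOn (fun y => phi a b c j ⟨x, y⟩ - phi a b c k ⟨x, y⟩) (Set.Ioc 0 y₀) := by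
    refine strictMonoOn_of_deriv_pos (convex_Ioc 0 y₀)
      (fun y hy => (hd y hy.1).continuousAt.continuousWithinAt) fun y hy => ?_
    rw [interior_Ioc] at hy
    have e := (hd y hy.1).deriv
    simp only [Pi.sub_def] at e
    rw [e]
    have h1 := hj y hy.1 hy.2.le
    have h2 := hk y hy.1 hy.2.le
    have n1 := hns j y hy.1
    have n2 := hns k y hy.1
    have r : ∀ p q r s : ℝ, p * (q / r) * s = p / r * (q * s) := fun p q r s => by ring
    rw [r, r, sub_pos]
    have h3 : constA a c b / normSq (uSheet a b c k ⟨x, y⟩) *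
        ((uSheet a b c k ⟨x, y⟩).im * densityForm a c (uSheet a b c k ⟨x, y⟩)) < 0 :=
      mul_neg_of_pos_of_neg (by positivity) h2
    exact h3.trans (by positivity)
  obtain ⟨y, hy, hyt, hl⟩ := hlim
  -- The limit only gives a weak inequality, at height y₀/2; strict growth from there to y₀ makes it
  -- strict.
  have hhalf : 0 < y₀ / 2 := by linarith
  have h1 : 0 ≤ phi a b c j ⟨x, y₀ / 2⟩ - phi a b c k ⟨x, y₀ / 2⟩ := by
    refine le_of_tendsto hl ?_
    filter_upwards [hyt.eventually (gt_mem_nhds hhalf)] with n hn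
    exact (hmono ⟨hy n, by linarith⟩ ⟨hhalf, by linarith⟩ hn).le
  exact h1.trans_lt (hmono ⟨hhalf, by linarith⟩ ⟨hy₀, le_rfl⟩ (by linarith))

theorem exists_lensRight_phi_sub_pos {a b c : ℝ} (h : GenericParams a b c) :
    ∃ δ : ℝ, 0 < δ ∧ ∀ z ∈ lensRight (beta a b c) δ, z.im ≠ 0 →
      0 < phi a b c .four z - phi a b c .two z := by
  have hb := h.b_pos
  have ha := h.one_lt_a
  have hab : b < a := h.b_lt_one.trans ha
  obtain ⟨δ, hδ, hQ⟩ := exists_lensRight_densityForm_pos h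
  have key : ∀ z ∈ lensRight (beta a b c) δ, 0 < z.im →
      0 < phi a b c .four z - phi a b c .two z := by
    rintro ⟨x, y₀⟩ ⟨hx, hy⟩ (hy₀ : 0 < y₀)
    have hx' : beta a b c < x := hx
    -- The lens contains the vertical segment from each of its points down to the cut.
    have hmem : ∀ y, 0 < y → y ≤ y₀ → (⟨x, y⟩ : ℂ) ∈ lensRight (beta a b c) δ := fun y h0 h1 =>
      ⟨hx, lt_of_le_of_lt (by simpa only [abs_of_pos h0, abs_of_pos hy₀] using h1) hy⟩
    refine phi_sub_pos_of_vertical ha hb hab hy₀ ?_ (fun y h0 h1 => ?_) (fun y h0 h1 => ?_)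
    · refine exists_phi_sub_tendsto_zero (l := .one) (m := .three) ha hb hab (by simp) (by simp)
        (by simp) (by simp) x fun u v hu0 hv0 hu hv h1 h2 h3 h4 => ?_
      obtain ⟨-, h5, h6⟩ := outer_cut_solutions ha hb hab (ofReal_im x) (by rw [ofReal_re]; exact hx'.le)
        hu0 hv0 hu hv h1 h2 h3 h4
      exact ⟨fun h7 => hx'.ne' (by simpa using h6 h7), h5⟩
    · exact mul_pos (uSheet_im_pos ha hb hab (by simp) h0) (hQ _ (hmem y h0 h1) h0).1
    · exact mul_neg_of_neg_of_pos (uSheet_two_im_neg ha hb hab h0) (hQ _ (hmem y h0 h1) h0).2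
  refine ⟨δ, hδ, fun z hz him => ?_⟩
  rcases lt_or_gt_of_ne him with h0 | h0
  · rw [← phi_conj ha hb hab him, ← phi_conj ha hb hab him]
    refine key _ ⟨by simpa using hz.1, by simpa using hz.2⟩ (by simpa using h0)
  · exact key z hz h0

theorem exists_lensBetween_phi_sub_pos {a b c : ℝ} (h : GenericParams a b c) :
    ∃ δ : ℝ, 0 < δ ∧ ∀ z ∈ lensBetween (-alpha a b c) (alpha a b c) δ, z.im ≠ 0 →
      0 < phi a b c .two z - phi a b c .one z := by
  have hb := h.b_pos
  have ha := h.one_lt_a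
  have hab : b < a := h.b_lt_one.trans ha
  obtain ⟨δ, hδ, hQ⟩ := exists_lensBetween_densityForm_neg h
  have key : ∀ z ∈ lensBetween (-alpha a b c) (alpha a b c) δ, 0 < z.im →
      0 < phi a b c .two z - phi a b c .one z := by
    rintro ⟨x, y₀⟩ ⟨⟨hx1, hy1⟩, ⟨hx2, hy2⟩⟩ (hy₀ : 0 < y₀)
    have hx : |x| < alpha a b c := abs_lt.2 ⟨hx1, hx2⟩
    have hmem : ∀ y, 0 < y → y ≤ y₀ →
        (⟨x, y⟩ : ℂ) ∈ lensBetween (-alpha a b c) (alpha a b c) δ := fun y h0 h1 =>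
      have h2 : |y| ≤ |y₀| := by rwa [abs_of_pos h0, abs_of_pos hy₀]
      ⟨⟨hx1, lt_of_le_of_lt h2 hy1⟩, ⟨hx2, lt_of_le_of_lt h2 hy2⟩⟩
    refine phi_sub_pos_of_vertical ha hb hab hy₀ ?_ (fun y h0 h1 => ?_) (fun y h0 h1 => ?_)
    · refine exists_phi_sub_tendsto_zero (l := .three) (m := .four) ha hb hab (by simp) (by simp)
        (by simp) (by simp) x fun u v hu0 hv0 hu hv h1 h2 h3 h4 => ?_
      obtain ⟨-, h5, h6⟩ := inner_cut_solutions ha hb hab (ofReal_im x) (by rw [ofReal_re]; exact hx.le)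
        hu0 hv0 hu hv h1 h2 h3 h4
      exact ⟨fun h7 => hx.ne (by simpa using h6 h7), h5⟩
    · exact mul_pos_of_neg_of_neg (uSheet_two_im_neg ha hb hab h0) (hQ _ (hmem y h0 h1) h0).2
    · exact mul_neg_of_pos_of_neg (uSheet_im_pos ha hb hab (by simp) h0) (hQ _ (hmem y h0 h1) h0).1
  refine ⟨δ, hδ, fun z hz him => ?_⟩
  rcases lt_or_gt_of_ne him with h0 | h0
  · rw [← phi_conj ha hb hab him, ← phi_conj ha hb hab him]
    exact key _ ⟨⟨by simpa using hz.1.1, by simpa using hz.1.2⟩,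
      ⟨by simpa using hz.2.1, by simpa using hz.2.2⟩⟩ (by simpa using h0)
  · exact key z hz h0

/-- The reflection u ↦ -u sends z to -z, exchanges sheets 3 and 4 and preserves Re Ω. -/
theorem exists_lensLeft_phi_sub_pos {a b c : ℝ} (h : GenericParams a b c) :
    ∃ δ : ℝ, 0 < δ ∧ ∀ z ∈ lensLeft (-beta a b c) δ, z.im ≠ 0 →
      0 < phi a b c .three z - phi a b c .two z := by
  have hb := h.b_pos
  have ha := h.one_lt_a
  have hab : b < a := h.b_lt_one.trans ha
  obtain ⟨δ, hδ, hp⟩ := exists_lensRight_phi_sub_pos h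
  refine ⟨δ, hδ, fun z hz him => ?_⟩
  have h1 : -z ∈ lensRight (beta a b c) δ := by
    refine ⟨?_, ?_⟩
    · rw [neg_re]; linarith [hz.1]
    · rw [neg_re, neg_im, abs_neg]
      have := hz.2
      rwa [show -z.re - beta a b c = -beta a b c - z.re by ring]
  have h2 := hp _ h1 (by simpa using him)
  have h3 : phi a b c .four (-z) = phi a b c .three z := phi_neg (j := .three) ha hb hab him
  have h4 : phi a b c .two (-z) = phi a b c .two z := phi_neg (j := .two) ha hb hab him
  rwa [h3, h4] at h2

end QuarticSpectralCurve

open QuarticSpectralCurve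
theorem proposition3p5 (a b c : ℝ) (h : GenericParams a b c) :
    (0 < alpha a b c ∧ alpha a b c < beta a b c) ∧
    (∀ j : Sheet,
      Set.BijOn (zMap a b c) (sheetRegion a b j) (sheetCut a b c j)ᶜ ∧
      DifferentiableOn ℂ (uSheet a b c j) (sheetCut a b c j)ᶜ) ∧
    (∃ δ : ℝ, 0 < δ ∧ ∀ z ∈ lensRight (beta a b c) δ, z.im ≠ 0 →
      0 < phi a b c .four z - phi a b c .two z) ∧
    (∃ δ : ℝ, 0 < δ ∧ ∀ z ∈ lensLeft (-beta a b c) δ, z.im ≠ 0 →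
      0 < phi a b c .three z - phi a b c .two z) ∧
    (∃ δ : ℝ, 0 < δ ∧ ∀ z ∈ lensBetween (-alpha a b c) (alpha a b c) δ, z.im ≠ 0 →
      0 < phi a b c .two z - phi a b c .one z) := by
  have hb := h.b_pos
  have ha := h.one_lt_a
  have hab : b < a := h.b_lt_one.trans ha
  exact ⟨⟨alpha_pos ha hb, alpha_lt_beta ha hb hab⟩,
    fun j => ⟨bijOn_zMap ha hb hab j, fun z hz =>
      (uSheet_hasDerivAt ha hb hab hz).differentiableAt.differentiableWithinAt⟩,
    exists_lensRight_phi_sub_pos h, exists_lensLeft_phi_sub_pos h, exists_lensBetween_phi_sub_pos h⟩
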